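/- Let $n\ge 0$ and equip $\mathbb R^{2n+1}$, with coordinates $(x_1,\dots,x_n,y_1,\dots,y_n,z)$, with its standard contact structure $\xi_{\mathrm{st}}=\ker\bigl(dz+\sum_{i=1}^n x_i\,dy_i\bigr)$. Let $(M,\xi)$ be a connected contact manifold of dimension $2n+1$, that is, $M$ is a connected smooth manifold without boundary (Hausdorff and second countable, not necessarily compact) and $\xi\subset TM$ is a field of hyperplanes that can be written near each point as the kernel of a smooth $1$-form $\alpha$ with $\alpha\wedge(d\alpha)^n$ nowhere zero. A contact chart for $(M,\xi)$ is a diffeomorphism $\phi$ from an open set $U\subset\mathbb R^{2n+1}$ onto an open subset of $M$ such that $\phi^*\xi=\xi_{\mathrm{st}}|_U$ and such that $(U,\xi_{\mathrm{st}})$ is contactomorphic to $(\mathbb R^{2n+1},\xi_{\mathrm{st}})$, i.e. there is a diffeomorphism $U\to\mathbb R^{2n+1}$ preserving $\xi_{\mathrm{st}}$. The image $\phi(U)$ of a contact chart is called a contact ball. Let $k\ge 1$, let $\mathcal U_1,\dots,\mathcal U_k$ be pairwise disjoint contact balls in $(M,\xi)$, and let $\mathcal K$ be a compact subset of $\mathcal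 U_1\cup\dots\cup\mathcal U_k$. Then there exists a single contact ball $\mathcal U\subset M$ with $\mathcal K\subset\mathcal U$. -/

import Mathlib

open Set Manifold
open scoped ContDiff

-- On products of function spaces, instance search would otherwise find a copy of `chartedSpaceSelf`
-- wrapped in `TopCat.of`.
attribute [-instance] TopCat.of.chartedSpace

noncomputable section

/-- The vector space `ℝ²ⁿ⁺¹ = ℝⁿ × ℝⁿ × ℝ`, with points written `(x, y, z)`. -/
abbrev ContactModel (n : ℕ) : Type := (Fin n → ℝ) × (Fin n → ℝ) × ℝ

/-- The standard contact form `dz + ∑ i, xᵢ dyᵢ` on `ℝ²ⁿ⁺¹`. -/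
def stdContactForm (n : ℕ) (u : ContactModel n) : ContactModel n →L[ℝ] ℝ :=
  (ContinuousLinearMap.snd ℝ (Fin n → ℝ) ℝ) ∘L
      (ContinuousLinearMap.snd ℝ (Fin n → ℝ) ((Fin n → ℝ) × ℝ)) +
    ∑ i : Fin n, u.1 i •
      ((ContinuousLinearMap.proj i : (Fin n → ℝ) →L[ℝ] ℝ) ∘L
        (ContinuousLinearMap.fst ℝ (Fin n → ℝ) ℝ) ∘L
          (ContinuousLinearMap.snd ℝ (Fin n → ℝ) ((Fin n → ℝ) × ℝ)))

/-- The exterior derivative at `u` of a `1`-form `α` on `ℝ²ⁿ⁺¹`, as a `2`-form. -/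
def dOneForm {n : ℕ} (α : ContactModel n → ContactModel n →L[ℝ] ℝ) (u : ContactModel n) :
    ContactModel n [⋀^Fin 2]→L[ℝ] ℝ :=
  extDeriv (fun w => ContinuousAlternatingMap.ofSubsingleton ℝ (ContactModel n) ℝ
    (0 : Fin 1) (α w)) u

/-- The value on `(v₀, …, v₂ₙ)` of the exterior product `a ∧ βⁿ` of a covector `a` and the `n`-th
exterior power of a `2`-form `β`:
`(a ∧ βⁿ)(v) = 2⁻ⁿ ∑ σ, sign σ · a (v_{σ 0}) · ∏ i < n, β (v_{σ (2i+1)}, v_{σ (2i+2)})`. -/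
def wedgePow {n : ℕ} (a : ContactModel n →L[ℝ] ℝ) (β : ContactModel n [⋀^Fin 2]→L[ℝ] ℝ)
    (v : Fin (2 * n + 1) → ContactModel n) : ℝ :=
  (1 / 2 : ℝ) ^ n * ∑ σ : Equiv.Perm (Fin (2 * n + 1)), ((Equiv.Perm.sign σ : ℤ) : ℝ) *
    (a (v (σ 0)) * ∏ i : Fin n,
      β ![v (σ ⟨2 * (i : ℕ) + 1, by omega⟩), v (σ ⟨2 * (i : ℕ) + 2, by omega⟩)])

/-- A field of linear subspaces `ξ p ⊆ T_p M` on a manifold `M` modelled on `ℝ²ⁿ⁺¹`. -/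
abbrev TangentDistribution (n : ℕ) (M : Type*) [TopologicalSpace M]
    [ChartedSpace (ContactModel n) M] :=
  (p : M) → Submodule ℝ (TangentSpace 𝓘(ℝ, ContactModel n) p)

/-- The standard contact structure `ξ_st = ker (dz + ∑ i, xᵢ dyᵢ)` on `ℝ²ⁿ⁺¹`. -/
def stdContactStructure (n : ℕ) : TangentDistribution n (ContactModel n) :=
  fun u => LinearMap.ker (stdContactForm n u).toLinearMap

section

variable {n : ℕ} {M : Type*} [TopologicalSpace M] [ChartedSpace (ContactModel n) M]

/-- The pullback `φ^* ξ` under a map `φ` (differentiable near `u`) from an open subset of `ℝ²ⁿ⁺¹`: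
`(φ^* ξ)_u = {v | dφ_u v ∈ ξ_{φ u}}`. -/
def pullbackDistribution (ξ : TangentDistribution n M) (φ : ContactModel n → M)
    (u : ContactModel n) : Submodule ℝ (TangentSpace 𝓘(ℝ, ContactModel n) u) :=
  (ξ (φ u)).comap
    (mfderiv 𝓘(ℝ, ContactModel n) 𝓘(ℝ, ContactModel n) φ u).toLinearMap

/-- `ξ` is a contact structure on `M`: in local coordinates around each point it is the kernel of a
smooth `1`-form `α` with `α ∧ (dα)ⁿ` nowhere zero. (In particular `α` is nowhere zero, so `ξ` is a
smooth field of hyperplanes.) -/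
def IsContactStructure (ξ : TangentDistribution n M) : Prop :=
  ∀ p : M, ∃ (W : Set (ContactModel n)) (α : ContactModel n → ContactModel n →L[ℝ] ℝ),
    IsOpen W ∧ chartAt (ContactModel n) p p ∈ W ∧ W ⊆ (chartAt (ContactModel n) p).target ∧
    ContDiffOn ℝ ∞ α W ∧
    ∀ u ∈ W,
      pullbackDistribution ξ (chartAt (ContactModel n) p).symm u
        = LinearMap.ker (α u).toLinearMap ∧
      ∃ v : Fin (2 * n + 1) → ContactModel n, wedgePow (α u) (dOneForm α u) v ≠ 0

/-- A Darboux chart of `(M, ξ)`, with domain the open set `φ.source ⊆ ℝ²ⁿ⁺¹`: a diffeomorphism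
from `φ.source` onto the open subset `φ.target` of `M` such that `φ^* ξ = ξ_st` on `φ.source`. -/
structure IsDarbouxChart (ξ : TangentDistribution n M)
    (φ : OpenPartialHomeomorph (ContactModel n) M) : Prop where
  contMDiffOn :
    ContMDiffOn 𝓘(ℝ, ContactModel n) 𝓘(ℝ, ContactModel n) ∞ φ φ.source
  contMDiffOn_symm :
    ContMDiffOn 𝓘(ℝ, ContactModel n) 𝓘(ℝ, ContactModel n) ∞ φ.symm φ.target
  pullback_eq : ∀ u ∈ φ.source, pullbackDistribution ξ φ u = stdContactStructure n u

end

/-- The subsets `U` and `V` of `ℝ²ⁿ⁺¹` are open, and there is a diffeomorphism `U → V` that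
preserves `ξ_st`. -/
def AreContactomorphic {n : ℕ} (U V : Set (ContactModel n)) : Prop :=
  ∃ ψ : OpenPartialHomeomorph (ContactModel n) (ContactModel n),
    ψ.source = U ∧ ψ.target = V ∧
    ContDiffOn ℝ ∞ ψ U ∧ ContDiffOn ℝ ∞ ψ.symm V ∧
    ∀ u ∈ U, (stdContactStructure n u).map (fderiv ℝ ψ u).toLinearMap
      = stdContactStructure n (ψ u)

/-- A contact ball of `(M, ξ)`: the image of a contact chart, that is, of a Darboux chart
whose domain is contactomorphic to `(ℝ²ⁿ⁺¹, ξ_st)`. -/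
def IsContactBall {n : ℕ} {M : Type*} [TopologicalSpace M] [ChartedSpace (ContactModel n) M]
    (ξ : TangentDistribution n M) (B : Set M) : Prop :=
  ∃ φ : OpenPartialHomeomorph (ContactModel n) M,
    IsDarbouxChart ξ φ ∧ AreContactomorphic φ.source (univ : Set (ContactModel n)) ∧ φ.target = B

end

/-! A diffeomorphism of `M` preserving `ξ` carries contact balls to contact balls, so it suffices to
move sets by flows of compactly supported contact Hamiltonians. Two motions are needed.

Squeezing (`IsContactBall.exists_symmetry_mapsTo`). A contact ball is a copy of the standard model
centred at any of its points, because Heisenberg translations preserve the standard form. The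
dilations `(e⁻ᵗx, e⁻ᵗy, e⁻²ᵗz)` preserve `ξ_st`. Cut off to compact support and iterated, they push
a compact subset of the ball into any neighbourhood of the centre.

Reaching a point (`IsContactStructure.exists_isContactBall_insert`). For `K` compact in a contact
ball, let `S` be the set of points that share a contact ball with `K`. It is open and nonempty. At a
boundary point, necessarily off `K`, a symmetry fixing `K` moves some point outside `S` into `S`,
and pulling back a ball contradicts the choice of that point. Such a symmetry exists because contact
fields take every value at a point: a point outside `S` nearest to some `s` in `S` is pushed towards
`s`. So `S` is clopen.

The balls are then merged by induction. A contact ball `B` containing the part of `K` treated so far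
is replaced by one that also meets the next ball `U j`. A symmetry `Φ` supported in `U j` squeezes
`K ∩ U j` into `B`. By disjointness `Φ` fixes the earlier part of `K`, so `Φ⁻¹(B)` contains both
parts.

Smooth flows come from inverting the Picard integral equation on the Banach space of paths. Small
multiples of the fields are enough, since the squeezing is iterated and the push may be short. -/

noncomputable section

/-! ### Smoothness of superposition operators on continuous functions. -/

section Nemytskii

variable {I : Type*} [TopologicalSpace I] [CompactSpace I]
  {F G : Type*} [NormedAddCommGroup F] [NormedSpace ℝ F] [NormedAddCommGroup G] [NormedSpace ℝ G]

/-- Pointwise application of a continuous family of operators to a continuous family of vectors. -/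
def pointwiseApply (I F G : Type*) [TopologicalSpace I] [CompactSpace I]
    [NormedAddCommGroup F] [NormedSpace ℝ F] [NormedAddCommGroup G] [NormedSpace ℝ G] :
    C(I, F →L[ℝ] G) →L[ℝ] C(I, F) →L[ℝ] C(I, G) :=
  LinearMap.mkContinuous₂
    (LinearMap.mk₂ ℝ (fun (A : C(I, F →L[ℝ] G)) (h : C(I, F)) =>
        (⟨fun t => A t (h t), A.continuous.clm_apply h.continuous⟩ : C(I, G)))
      (fun A A' h => by ext t; simp) (fun c A h => by ext t; simp)
      (fun A h h' => by ext t; simp) (fun c A h => by ext t; simp)) 1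
    (fun A h => by
      rw [ContinuousMap.norm_le _ (by positivity)]
      intro t
      simp only [LinearMap.mk₂_apply, ContinuousMap.coe_mk, one_mul]
      exact ((A t).le_opNorm _).trans
        (mul_le_mul (A.norm_coe_le_norm t) (h.norm_coe_le_norm t) (norm_nonneg _) (norm_nonneg A)))

@[simp] lemma pointwiseApply_apply (A : C(I, F →L[ℝ] G)) (h : C(I, F)) (t : I) :
    pointwiseApply I F G A h t = A t (h t) := rfl

/-- The superposition operator `γ ↦ V ∘ γ` on continuous functions. -/
def superposition (I : Type*) [TopologicalSpace I] {F G : Type*} [TopologicalSpace F]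
    [TopologicalSpace G] (V : C(F, G)) : C(I, F) → C(I, G) := fun γ => V.comp γ

@[simp] lemma superposition_apply {I F G : Type*} [TopologicalSpace I] [TopologicalSpace F]
    [TopologicalSpace G] (V : C(F, G)) (γ : C(I, F)) (t : I) :
    superposition I V γ t = V (γ t) := rfl

lemma continuous_superposition {I F G : Type*} [TopologicalSpace I] [TopologicalSpace F]
    [TopologicalSpace G] (V : C(F, G)) : Continuous (superposition I V) :=
  ContinuousMap.continuous_postcomp V

/-- The error at each `t` is bounded by the mean value inequality on the segment from `γ t` to `η
t`. Continuity of `V' ∘ ·` in the sup norm makes the bound uniform in `t`. -/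
lemma hasFDerivAt_superposition (V : C(F, G)) (V' : C(F, F →L[ℝ] G))
    (h : ∀ u, HasFDerivAt V (V' u) u) (γ : C(I, F)) :
    HasFDerivAt (superposition I V) (pointwiseApply I F G (superposition I V' γ)) γ := by
  rw [hasFDerivAt_iff_isLittleO, Asymptotics.isLittleO_iff]
  intro c hc
  have hcont := (continuous_superposition (I := I) V').continuousAt (x := γ)
  obtain ⟨δ, hδ, hball⟩ := (Metric.continuousAt_iff
    (f := (superposition I V' : C(I, F) → C(I, F →L[ℝ] G)))).1 hcont c hc
  filter_upwards [Metric.ball_mem_nhds γ hδ] with η hη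
  rw [ContinuousMap.norm_le _ (by positivity)]
  intro t
  have key := (convex_segment (𝕜 := ℝ) (γ t) (η t)).norm_image_sub_le_of_norm_hasFDerivWithin_le'
    (f := V) (f' := V') (φ := V' (γ t)) (C := c) (x := γ t) (y := η t)
    (fun x _ => (h x).hasFDerivWithinAt) ?_ (left_mem_segment _ _ _) (right_mem_segment _ _ _)
  · simp only [ContinuousMap.sub_apply, superposition_apply, pointwiseApply_apply]
    exact key.trans (mul_le_mul_of_nonneg_left ((η - γ).norm_coe_le_norm t) hc.le)
  · rintro x ⟨a, b, ha, hb, hab, rfl⟩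
    have hmem : a • γ + b • η ∈ Metric.ball γ δ :=
      convex_ball γ δ (Metric.mem_ball_self hδ) hη ha hb hab
    have h1 := (hball hmem).le
    have h2 := (ContinuousMap.dist_apply_le_dist (f := superposition I V' (a • γ + b • η))
      (g := superposition I V' γ) t).trans h1
    rwa [dist_eq_norm] at h2

end Nemytskii

universe u

/-- Induction on the order: the derivative is a superposition operator with values in `F →L[ℝ] G`,
followed by a bounded linear map. The target therefore varies in the induction, and the common
universe of `F` and `G` also holds the operator space. -/
lemma contDiff_superposition_nat {I : Type*} [TopologicalSpace I] [CompactSpace I]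
    {F : Type u} [NormedAddCommGroup F] [NormedSpace ℝ F] (k : ℕ) :
    ∀ {G : Type u} [NormedAddCommGroup G] [NormedSpace ℝ G] (V : C(F, G)),
      ContDiff ℝ ∞ V → ContDiff ℝ k (superposition I V) := by
  induction k with
  | zero =>
    intro G _ _ V hV
    exact_mod_cast contDiff_zero.2 (continuous_superposition V)
  | succ k ih =>
    intro G _ _ V hV
    have hV' : ContDiff ℝ ∞ (fderiv ℝ V) := hV.fderiv_right le_rfl
    let V' : C(F, F →L[ℝ] G) := ⟨fderiv ℝ V, hV'.continuous⟩
    push_cast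
    rw [contDiff_succ_iff_hasFDerivAt]
    refine ⟨fun γ => pointwiseApply I F G (superposition I V' γ), ?_, ?_⟩
    · exact (pointwiseApply I F G).contDiff.comp (ih V' hV')
    · exact fun γ => hasFDerivAt_superposition V V'
        (fun u => (hV.differentiable (by simp) u).hasFDerivAt) γ

lemma contDiff_superposition {I : Type*} [TopologicalSpace I] [CompactSpace I]
    {F G : Type u} [NormedAddCommGroup F] [NormedSpace ℝ F]
    [NormedAddCommGroup G] [NormedSpace ℝ G] (V : C(F, G)) (hV : ContDiff ℝ ∞ V) :
    ContDiff ℝ ∞ (superposition I V) :=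
  contDiff_infty.2 fun k => contDiff_superposition_nat k V hV

/-! ### Flows for unit time, smooth in the initial point. -/

section Flow

/-- The extension to the real line of a continuous function on the unit interval, constant outside
the interval. -/
def extendUnit {F : Type*} [NormedAddCommGroup F] (γ : C(Icc (0 : ℝ) 1, F)) (t : ℝ) : F :=
  γ (projIcc 0 1 zero_le_one t)

lemma continuous_extendUnit {F : Type*} [NormedAddCommGroup F]
    (γ : C(Icc (0 : ℝ) 1, F)) : Continuous (extendUnit γ) :=
  γ.continuous.comp continuous_projIcc

lemma extendUnit_of_mem {F : Type*} [NormedAddCommGroup F]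
    (γ : C(Icc (0 : ℝ) 1, F)) {t : ℝ} (ht : t ∈ Icc (0 : ℝ) 1) :
    extendUnit γ t = γ ⟨t, ht⟩ := by
  simp [extendUnit, projIcc_of_mem _ ht]

lemma norm_extendUnit_le {F : Type*} [NormedAddCommGroup F]
    (γ : C(Icc (0 : ℝ) 1, F)) (t : ℝ) : ‖extendUnit γ t‖ ≤ ‖γ‖ :=
  γ.norm_coe_le_norm _

variable {F : Type u} [NormedAddCommGroup F] [NormedSpace ℝ F] [CompleteSpace F]

/-- The integration operator `γ ↦ (t ↦ ∫₀ᵗ γ)` on continuous functions on the unit interval. -/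
def volterra (F : Type*) [NormedAddCommGroup F] [NormedSpace ℝ F] [CompleteSpace F] :
    C(Icc (0 : ℝ) 1, F) →L[ℝ] C(Icc (0 : ℝ) 1, F) :=
  LinearMap.mkContinuous
    { toFun := fun γ => ⟨fun t => ∫ s in (0 : ℝ)..t, extendUnit γ s,
        (intervalIntegral.continuous_primitive
          (fun a b => (continuous_extendUnit γ).intervalIntegrable a b) 0).comp
            continuous_subtype_val⟩
      map_add' := fun γ η => by
        ext t
        exact intervalIntegral.integral_add ((continuous_extendUnit γ).intervalIntegrable _ _)
          ((continuous_extendUnit η).intervalIntegrable _ _)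
      map_smul' := fun c γ => by
        ext t
        exact intervalIntegral.integral_smul c _ } 1
    (fun γ => by
      rw [ContinuousMap.norm_le _ (by positivity)]
      rintro ⟨t, ht⟩
      have h := intervalIntegral.norm_integral_le_of_norm_le_const (a := 0) (b := t)
        (f := extendUnit γ) (C := ‖γ‖) (fun s _ => norm_extendUnit_le γ s)
      refine h.trans ?_
      rw [sub_zero, abs_of_nonneg ht.1, one_mul]
      exact mul_le_of_le_one_right (norm_nonneg γ) ht.2)

@[simp] lemma volterra_apply (γ : C(Icc (0 : ℝ) 1, F)) (t : Icc (0 : ℝ) 1) :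
    volterra F γ t = ∫ s in (0 : ℝ)..t, extendUnit γ s := rfl

lemma norm_volterra_le : ‖volterra F‖ ≤ 1 := LinearMap.mkContinuous_norm_le _ zero_le_one _

lemma hasDerivWithinAt_extendUnit {γ η : C(Icc (0 : ℝ) 1, F)} {u : F}
    (h : γ = ContinuousMap.const _ u + volterra F η) {t : ℝ} (ht : t ∈ Icc (0 : ℝ) 1) :
    HasDerivWithinAt (extendUnit γ) (extendUnit η t) (Icc 0 1) t := by
  have h1 : HasDerivAt (fun t => u + ∫ s in (0 : ℝ)..t, extendUnit η s) (extendUnit η t) t :=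
    (intervalIntegral.integral_hasDerivAt_right
      ((continuous_extendUnit η).intervalIntegrable _ _)
      ((continuous_extendUnit η).stronglyMeasurableAtFilter _ _)
      (continuous_extendUnit η).continuousAt).const_add u
  refine h1.hasDerivWithinAt.congr (fun s hs => ?_) ?_
  · rw [extendUnit_of_mem γ hs, h]; simp
  · rw [extendUnit_of_mem γ ht, h]; simp

/-- The integral operator whose value at `γ` is constant iff `γ` solves `γ' = V(γ)`. -/
def odeDefect (V : C(F, F)) (γ : C(Icc (0 : ℝ) 1, F)) : C(Icc (0 : ℝ) 1, F) :=
  γ - volterra F (superposition _ V γ)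

lemma contDiff_odeDefect (V : C(F, F)) (hV : ContDiff ℝ ∞ V) : ContDiff ℝ ∞ (odeDefect V) :=
  contDiff_id.sub ((volterra F).contDiff.comp (contDiff_superposition V hV))

lemma lipschitzWith_volterra_superposition {V : C(F, F)} {K : NNReal} (hK : LipschitzWith K V) :
    LipschitzWith K (fun γ => volterra F (superposition (Icc (0 : ℝ) 1) V γ)) := by
  refine LipschitzWith.of_dist_le_mul fun γ η => ?_
  rw [dist_eq_norm, ← map_sub]
  refine ((volterra F).le_opNorm _).trans ?_
  refine (mul_le_mul_of_nonneg_right norm_volterra_le (norm_nonneg _)).trans ?_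
  rw [one_mul, ContinuousMap.norm_le _ (by positivity)]
  intro t
  have := hK.dist_le_mul (γ t) (η t)
  rw [dist_eq_norm] at this
  exact this.trans (mul_le_mul_of_nonneg_left (ContinuousMap.dist_apply_le_dist t) K.2)

lemma approximatesLinearOn_odeDefect {V : C(F, F)} {K : NNReal} (hK : LipschitzWith K V) :
    ApproximatesLinearOn (odeDefect V)
      ((ContinuousLinearEquiv.refl ℝ C(Icc (0 : ℝ) 1, F) :
        C(Icc (0 : ℝ) 1, F) ≃L[ℝ] C(Icc (0 : ℝ) 1, F)) :
          C(Icc (0 : ℝ) 1, F) →L[ℝ] C(Icc (0 : ℝ) 1, F)) univ K := by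
  intro γ _ η _
  have := (lipschitzWith_volterra_superposition hK).dist_le_mul γ η
  rw [dist_eq_norm, dist_eq_norm, ← norm_neg] at this
  convert! this using 2
  simp only [odeDefect, ContinuousLinearEquiv.coe_coe, ContinuousLinearEquiv.refl_apply]
  abel

/-- The left side of Picard's equation `γ - ∫ V(γ) = u` is the identity minus a contraction, hence a
homeomorphism of the path space with smooth inverse. Smooth dependence on the initial point is the
smoothness of this inverse along constant paths. -/
lemma exists_flow_path {V : C(F, F)} {K : NNReal} (hV : ContDiff ℝ ∞ V)
    (hK : LipschitzWith K V) (hK1 : K < 1) :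
    ∃ S : F → C(Icc (0 : ℝ) 1, F), ContDiff ℝ ∞ S ∧
      ∀ u, odeDefect V (S u) = ContinuousMap.const _ u := by
  have hc : Subsingleton C(Icc (0 : ℝ) 1, F) ∨ K < ‖((ContinuousLinearEquiv.refl ℝ
      C(Icc (0 : ℝ) 1, F)).symm : C(Icc (0 : ℝ) 1, F) →L[ℝ] C(Icc (0 : ℝ) 1, F))‖₊⁻¹ := by
    rcases subsingleton_or_nontrivial C(Icc (0 : ℝ) 1, F) with h | h
    · exact Or.inl h
    · right
      have : ‖((ContinuousLinearEquiv.refl ℝ C(Icc (0 : ℝ) 1, F)).symm :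
          C(Icc (0 : ℝ) 1, F) →L[ℝ] C(Icc (0 : ℝ) 1, F))‖₊ = 1 :=
        NNReal.eq ContinuousLinearMap.norm_id
      rw [this, inv_one]
      exact hK1
  let Ψ : C(Icc (0 : ℝ) 1, F) ≃ₜ C(Icc (0 : ℝ) 1, F) :=
    (approximatesLinearOn_odeDefect hK).toHomeomorph _ hc
  have hΨ : ∀ γ, Ψ γ = odeDefect V γ := fun γ => rfl
  let N : C(Icc (0 : ℝ) 1, F) → C(Icc (0 : ℝ) 1, F) := fun γ => volterra F (superposition _ V γ)
  have hN : ContDiff ℝ ∞ N := (volterra F).contDiff.comp (contDiff_superposition V hV)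
  have hnorm : ∀ γ, ‖fderiv ℝ N γ‖ < 1 := fun γ =>
    (((hN.differentiable (by simp) γ).hasFDerivAt).le_of_lipschitz
      (lipschitzWith_volterra_superposition hK)).trans_lt (by exact_mod_cast hK1)
  -- The derivative `1 - fderiv ℝ N γ` is invertible by the Neumann series.
  have hsymm : ContDiff ℝ ∞ Ψ.symm :=
    Ψ.contDiff_symm (f₀' := fun γ => ContinuousLinearEquiv.ofUnit
        (Units.oneSub (fderiv ℝ N γ) (hnorm γ)))
      (fun γ => (hasFDerivAt_id γ).sub (hN.differentiable (by simp) γ).hasFDerivAt)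
      (contDiff_odeDefect V hV)
  refine ⟨fun u => Ψ.symm (ContinuousMap.const _ u),
    hsymm.comp (ContinuousLinearMap.const ℝ (Icc (0 : ℝ) 1) (M := F)).contDiff, fun u => ?_⟩
  rw [← hΨ, Homeomorph.apply_symm_apply]

/-- `φ` is the flow, for times in `[0, 1]`, of the vector field `V`; it is smooth and satisfies the
variational equation. -/
structure IsUnitFlow (V : F → F) (φ : ℝ → F → F) : Prop where
  zero : ∀ u, φ 0 u = u
  deriv : ∀ t ∈ Icc (0 : ℝ) 1, ∀ u, HasDerivWithinAt (fun s => φ s u) (V (φ t u)) (Icc 0 1) t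
  contDiff : ∀ t, ContDiff ℝ ∞ (φ t)
  variation : ∀ t ∈ Icc (0 : ℝ) 1, ∀ u v, HasDerivWithinAt (fun s => fderiv ℝ (φ s) u v)
    (fderiv ℝ V (φ t u) (fderiv ℝ (φ t) u v)) (Icc 0 1) t

/-- A smooth vector field with Lipschitz constant less than one has a flow for times in `[0, 1]`. -/
theorem exists_isUnitFlow {V : F → F} {K : NNReal} (hV : ContDiff ℝ ∞ V)
    (hK : LipschitzWith K V) (hK1 : K < 1) : ∃ φ : ℝ → F → F, IsUnitFlow V φ := by
  let Vc : C(F, F) := ⟨V, hV.continuous⟩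
  obtain ⟨S, hS, hSu⟩ := exists_flow_path (V := Vc) hV hK hK1
  have hS' : ∀ u, S u = ContinuousMap.const _ u + volterra F (superposition _ Vc (S u)) := by
    intro u
    rw [← hSu u, odeDefect]; abel
  have hV' : ContDiff ℝ ∞ (fderiv ℝ V) := hV.fderiv_right le_rfl
  let V' : C(F, F →L[ℝ] F) := ⟨fderiv ℝ V, hV'.continuous⟩
  have hfd : ∀ t u v, fderiv ℝ (fun u => extendUnit (S u) t) u v
      = extendUnit (fderiv ℝ S u v) t := by
    intro t u v
    have h1 := (hS.differentiable (by simp) u).hasFDerivAt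
    have h2 := ((ContinuousMap.evalCLM ℝ (projIcc (0 : ℝ) 1 zero_le_one t) :
      C(Icc (0 : ℝ) 1, F) →L[ℝ] F).hasFDerivAt (x := S u)).comp u h1
    exact congrArg (fun A : F →L[ℝ] F => A v) h2.fderiv
  -- Differentiating the integral equation in the initial point gives a linear integral equation,
  -- which yields the variational equation just as the original one yields the flow equation.
  have hvar : ∀ u v, fderiv ℝ S u v = ContinuousMap.const _ v + volterra F
      (pointwiseApply _ F F (superposition _ V' (S u)) (fderiv ℝ S u v)) := by
    intro u v
    have h1 := (hS.differentiable (by simp) u).hasFDerivAt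
    have h2 := (hasFDerivAt_superposition Vc V'
      (fun w => (hV.differentiable (by simp) w).hasFDerivAt) (S u)).comp u h1
    have h3 := ((ContinuousLinearMap.const ℝ (Icc (0 : ℝ) 1) (M := F)).hasFDerivAt (x := u)).add
      ((volterra F).hasFDerivAt.comp u h2)
    have h4 : HasFDerivAt S _ u := h3.congr_of_eventuallyEq (Filter.Eventually.of_forall hS')
    exact congrArg (fun A : F →L[ℝ] C(Icc (0 : ℝ) 1, F) => A v) (h1.unique h4)
  refine ⟨fun t u => extendUnit (S u) t, fun u => ?_, fun t ht u => ?_, fun t => ?_,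
    fun t ht u v => ?_⟩
  · rw [extendUnit_of_mem _ (left_mem_Icc.2 zero_le_one), hS' u]; simp
  · exact hasDerivWithinAt_extendUnit (hS' u) ht
  · exact (ContinuousMap.evalCLM ℝ (projIcc (0 : ℝ) 1 zero_le_one t) :
      C(Icc (0 : ℝ) 1, F) →L[ℝ] F).contDiff.comp hS
  · simp only [hfd]
    exact hasDerivWithinAt_extendUnit (hvar u v) ht

end Flow

/-! ### Flows that preserve the kernels of a one-form. -/

section FlowDiffeo

variable {F : Type u} [NormedAddCommGroup F] [NormedSpace ℝ F]

namespace IsUnitFlow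

variable {V : F → F} {φ ψ : ℝ → F → F} {K : NNReal}

lemma continuousOn (h : IsUnitFlow V φ) (u : F) :
    ContinuousOn (fun s => φ s u) (Icc 0 1) :=
  fun t ht => (h.deriv t ht u).continuousWithinAt

/-- A solution of the differential equation on `[0, t]` is given by the flow. -/
lemma eq_of_solution (h : IsUnitFlow V φ) (hK : LipschitzWith K V) {t : ℝ}
    (ht : t ∈ Icc (0 : ℝ) 1) {γ : ℝ → F}
    (hγ : ∀ s ∈ Icc 0 t, HasDerivWithinAt γ (V (γ s)) (Icc 0 t) s) : φ t (γ 0) = γ t := by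
  have hsub : Icc 0 t ⊆ Icc (0 : ℝ) 1 := Icc_subset_Icc_right ht.2
  have hIci : ∀ s ∈ Ico 0 t, Icc 0 t ∈ nhdsWithin s (Ici s) := fun s hs =>
    Icc_mem_nhdsGE_of_mem hs
  exact ODE_solution_unique (v := fun _ => V) (fun _ => hK) ((h.continuousOn (γ 0)).mono hsub)
    (fun s hs => ((h.deriv s (hsub (Ico_subset_Icc_self hs)) _).mono hsub).mono_of_mem_nhdsWithin
      (hIci s hs))
    (fun s hs => (hγ s hs).continuousWithinAt)
    (fun s hs => (hγ s (Ico_subset_Icc_self hs)).mono_of_mem_nhdsWithin (hIci s hs))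
    (h.zero _) (right_mem_Icc.2 ht.1)

lemma eq_self_of_eq_zero (h : IsUnitFlow V φ) (hK : LipschitzWith K V) {t : ℝ}
    (ht : t ∈ Icc (0 : ℝ) 1) {u : F} (hu : V u = 0) : φ t u = u :=
  h.eq_of_solution hK ht (γ := fun _ => u) fun s _ => by
    rw [hu]; exact hasDerivWithinAt_const _ _ _

/-- The orbit run backwards from time `t` solves the equation of `-V`, so uniqueness identifies it
with an orbit of `ψ`. -/
lemma leftInverse (h : IsUnitFlow V φ) (h' : IsUnitFlow (-V) ψ) (hK : LipschitzWith K V) {t : ℝ}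
    (ht : t ∈ Icc (0 : ℝ) 1) : Function.LeftInverse (ψ t) (φ t) := by
  intro u
  have key := h'.eq_of_solution hK.neg ht (γ := fun s => φ (t - s) u) fun s hs => by
    have hmaps : MapsTo (fun s => t - s) (Icc 0 t) (Icc (0 : ℝ) 1) := fun r hr =>
      ⟨by linarith [hr.2], by linarith [hr.1, ht.2]⟩
    have h1 := (h.deriv (t - s) (hmaps hs) u).scomp s
      ((hasDerivAt_id s).const_sub t).hasDerivWithinAt hmaps
    simpa [Function.comp_def] using h1
  simpa [h.zero] using key

variable {C : Set F}

/-- A point off `C` is stationary for the inverse flow, so an orbit starting in `C` cannot reach it.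
-/
lemma mem_of_mem (h : IsUnitFlow V φ) (h' : IsUnitFlow (-V) ψ) (hK : LipschitzWith K V)
    (hC : ∀ u ∉ C, V u = 0) {t : ℝ} (ht : t ∈ Icc (0 : ℝ) 1) {u : F} (hu : u ∈ C) :
    φ t u ∈ C := by
  by_contra hn
  have h1 : ψ t (φ t u) = φ t u := h'.eq_self_of_eq_zero hK.neg ht (by simp [hC _ hn])
  rw [h.leftInverse h' hK ht u] at h1
  exact hn (h1 ▸ hu)

/-- If the Lie derivative along `V` of a one-form `α` is a multiple of `α`, then the flow of `V`
preserves the kernel of `α`. -/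
lemma map_ker (h : IsUnitFlow V φ) (h' : IsUnitFlow (-V) ψ) (hK : LipschitzWith K V)
    (hC : ∀ u ∉ C, V u = 0) (hCc : IsCompact C) {α : F → F →L[ℝ] ℝ} {μ : F → ℝ}
    (hα : ∀ u ∈ C, DifferentiableAt ℝ α u) (hμ : ContinuousOn μ C)
    (hL : ∀ u ∈ C, ∀ v, fderiv ℝ α u (V u) v + α u (fderiv ℝ V u v) = μ u * α u v)
    {t : ℝ} (ht : t ∈ Icc (0 : ℝ) 1) {u : F} (hu : u ∈ C) {v : F} (hv : α u v = 0) :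
    α (φ t u) (fderiv ℝ (φ t) u v) = 0 := by
  have hmem : ∀ s ∈ Icc (0 : ℝ) 1, φ s u ∈ C := fun s hs => h.mem_of_mem h' hK hC hs hu
  -- The variational equation and `hL` make `g' = μ g` for the value `g` of `α` on the transported
  -- vector. As `μ` is bounded on `C` and `g` starts at zero, Grönwall's inequality keeps it zero.
  have hg : ∀ s ∈ Icc (0 : ℝ) 1, HasDerivWithinAt (fun s => α (φ s u) (fderiv ℝ (φ s) u v))
      (μ (φ s u) * α (φ s u) (fderiv ℝ (φ s) u v)) (Icc 0 1) s := by
    intro s hs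
    have h1 : HasDerivWithinAt (fun s => α (φ s u)) (fderiv ℝ α (φ s u) (V (φ s u))) (Icc 0 1) s :=
      (hα _ (hmem s hs)).hasFDerivAt.comp_hasDerivWithinAt s (h.deriv s hs u)
    have h2 := h1.clm_apply (h.variation s hs u v)
    rwa [hL _ (hmem s hs)] at h2
  obtain ⟨B, hB⟩ := hCc.exists_bound_of_continuousOn hμ
  have hIci : ∀ s ∈ Ico (0 : ℝ) 1, Icc (0 : ℝ) 1 ∈ nhdsWithin s (Ici s) := fun s hs =>
    Icc_mem_nhdsGE_of_mem hs
  refine eq_zero_of_abs_deriv_le_mul_abs_self_of_eq_zero_right (K := B)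
    (fun s hs => (hg s hs).continuousWithinAt)
    (fun s hs => (hg s (Ico_subset_Icc_self hs)).mono_of_mem_nhdsWithin (hIci s hs)) ?_ ?_ t ht
  · have : φ 0 = id := funext h.zero
    simp [this, hv]
  · intro s hs
    rw [norm_mul]
    exact mul_le_mul_of_nonneg_right (hB _ (hmem s (Ico_subset_Icc_self hs))) (norm_nonneg _)

end IsUnitFlow

/-- `f` is a diffeomorphism of `F` that is the identity off `C` and preserves, on `C`, the field of
kernels of the one-form `α`. -/
structure PreservesKer (α : F → F →L[ℝ] ℝ) (C : Set F) (f : F ≃ F) : Prop where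
  contDiff : ContDiff ℝ ∞ f
  contDiff_symm : ContDiff ℝ ∞ f.symm
  eq_self : ∀ u ∉ C, f u = u
  map_ker : ∀ u ∈ C, ∀ v, α u v = 0 → α (f u) (fderiv ℝ f u v) = 0
  map_ker_symm : ∀ u ∈ C, ∀ v, α u v = 0 → α (f.symm u) (fderiv ℝ f.symm u v) = 0

lemma PreservesKer.symm {α : F → F →L[ℝ] ℝ} {C : Set F} {f : F ≃ F} (h : PreservesKer α C f) :
    PreservesKer α C f.symm where
  contDiff := h.contDiff_symm
  contDiff_symm := h.contDiff
  eq_self u hu := by rw [Equiv.symm_apply_eq, h.eq_self u hu]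
  map_ker := h.map_ker_symm
  map_ker_symm := h.map_ker

lemma PreservesKer.mem {α : F → F →L[ℝ] ℝ} {C : Set F} {f : F ≃ F} (h : PreservesKer α C f)
    {u : F} (hu : u ∈ C) : f u ∈ C := by
  by_contra hn
  have := f.injective (h.eq_self _ hn)
  exact hn (this.symm ▸ hu)

/-- `V` is an infinitesimal symmetry, supported in `C`, of the field of kernels of `α`. -/
structure IsInfinitesimalSymmetry (α : F → F →L[ℝ] ℝ) (C : Set F) (V : F → F) : Prop where
  contDiff : ContDiff ℝ ∞ V
  eq_zero : ∀ u ∉ C, V u = 0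
  lieDeriv : ∃ μ : F → ℝ, ContinuousOn μ C ∧
    ∀ u ∈ C, ∀ v, fderiv ℝ α u (V u) v + α u (fderiv ℝ V u v) = μ u * α u v

lemma IsInfinitesimalSymmetry.smul {α : F → F →L[ℝ] ℝ} {C : Set F} {V : F → F}
    (h : IsInfinitesimalSymmetry α C V) (c : ℝ) : IsInfinitesimalSymmetry α C (c • V) where
  contDiff := contDiff_const.smul h.contDiff
  eq_zero u hu := by simp [h.eq_zero u hu]
  lieDeriv := by
    obtain ⟨μ, hμ, hL⟩ := h.lieDeriv
    refine ⟨fun u => c * μ u, continuousOn_const.mul hμ, fun u hu v => ?_⟩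
    have h1 : fderiv ℝ (c • V) u = c • fderiv ℝ V u :=
      fderiv_const_smul (h.contDiff.differentiable (by simp) u) c
    rw [h1, mul_assoc, ← hL u hu v]
    simp [mul_add]

/-- A small multiple of a compactly supported infinitesimal symmetry has a flow, for times in
`[0, 1]`, by symmetries. -/
theorem IsInfinitesimalSymmetry.exists_flow [FiniteDimensional ℝ F]
    {α : F → F →L[ℝ] ℝ} {C : Set F} {V : F → F}
    (h : IsInfinitesimalSymmetry α C V) (hC : IsCompact C)
    (hα : ∀ u ∈ C, DifferentiableAt ℝ α u) :
    ∃ c : ℝ, 0 < c ∧ ∃ K : NNReal, LipschitzWith K (c • V) ∧ ∃ φ : ℝ → F → F,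
      IsUnitFlow (c • V) φ ∧
      ∀ t ∈ Icc (0 : ℝ) 1, ∃ f : F ≃ F, ⇑f = φ t ∧ PreservesKer α C f := by
  have : CompleteSpace F := FiniteDimensional.complete ℝ F
  have hsupp : HasCompactSupport V := HasCompactSupport.intro hC h.eq_zero
  obtain ⟨K, hK⟩ := h.contDiff.lipschitzWith_of_hasCompactSupport hsupp (by simp)
  -- This rescaling of time brings the Lipschitz constant below one.
  let c : NNReal := (K + 1)⁻¹
  have hc : 0 < c := by positivity
  have hKc : LipschitzWith (c * K) ((c : ℝ) • V) := by
    have := (lipschitzWith_smul (c : ℝ) (β := F)).comp hK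
    simpa using! this
  have hlt : c * K < 1 := by
    rw [inv_mul_lt_iff₀ (by positivity)]; simp
  have hs := h.smul c
  have hs' := hs.smul (-1)
  rw [neg_one_smul] at hs'
  obtain ⟨φ, hφ⟩ := exists_isUnitFlow hs.contDiff hKc hlt
  obtain ⟨ψ, hψ⟩ := exists_isUnitFlow hs'.contDiff hKc.neg hlt
  refine ⟨c, hc, c * K, hKc, φ, hφ, fun t ht => ?_⟩
  have hφ' : IsUnitFlow (-(-((c : ℝ) • V))) φ := by rwa [neg_neg]
  obtain ⟨μ, hμ, hL⟩ := hs.lieDeriv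
  obtain ⟨μ', hμ', hL'⟩ := hs'.lieDeriv
  exact ⟨⟨φ t, ψ t, hφ.leftInverse hψ hKc ht, hψ.leftInverse hφ' hKc.neg ht⟩, rfl,
    { contDiff := hφ.contDiff t
      contDiff_symm := hψ.contDiff t
      eq_self := fun u hu => hφ.eq_self_of_eq_zero hKc ht (hs.eq_zero u hu)
      map_ker := fun u hu v hv => hφ.map_ker hψ hKc hs.eq_zero hC hα hμ hL ht hu hv
      map_ker_symm := fun u hu v hv =>
        hψ.map_ker hφ' hKc.neg hs'.eq_zero hC hα hμ' hL' ht hu hv }⟩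

end FlowDiffeo

/-! ### Contact forms and contact Hamiltonians. -/

section ContactHamiltonian

variable {F : Type u} [NormedAddCommGroup F] [NormedSpace ℝ F]

/-- The exterior derivative of a one-form, as a bilinear map. -/
def oneFormCurl (α : F → F →L[ℝ] ℝ) (u : F) : F →L[ℝ] F →L[ℝ] ℝ :=
  fderiv ℝ α u - (fderiv ℝ α u).flip

lemma oneFormCurl_apply (α : F → F →L[ℝ] ℝ) (u v w : F) :
    oneFormCurl α u v w = fderiv ℝ α u v w - fderiv ℝ α u w v := rfl

lemma oneFormCurl_self (α : F → F →L[ℝ] ℝ) (u v : F) : oneFormCurl α u v v = 0 := by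
  simp [oneFormCurl_apply]

lemma oneFormCurl_swap (α : F → F →L[ℝ] ℝ) (u v w : F) :
    oneFormCurl α u v w = -oneFormCurl α u w v := by
  simp [oneFormCurl_apply]

/-- `α` is a smooth contact form on the open set `W`. -/
structure IsContactFormOn (α : F → F →L[ℝ] ℝ) (W : Set F) : Prop where
  isOpen : IsOpen W
  contDiffOn : ContDiffOn ℝ ∞ α W
  nondegenerate : ∀ u ∈ W, ∀ v, α u v = 0 → oneFormCurl α u v = 0 → v = 0
  reeb : ∀ u ∈ W, ∃ r, α u r = 1 ∧ oneFormCurl α u r = 0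

lemma IsContactFormOn.mono {α : F → F →L[ℝ] ℝ} {W W' : Set F} (h : IsContactFormOn α W)
    (hW' : IsOpen W') (hsub : W' ⊆ W) : IsContactFormOn α W' :=
  ⟨hW', h.contDiffOn.mono hsub, fun u hu => h.nondegenerate u (hsub hu),
    fun u hu => h.reeb u (hsub hu)⟩

/-- The linear map `v ↦ dα(v, ·) + α(v) α`. -/
def contactOperator (α : F → F →L[ℝ] ℝ) (u : F) : F →L[ℝ] F →L[ℝ] ℝ :=
  oneFormCurl α u + (α u).smulRight (α u)

lemma contactOperator_apply (α : F → F →L[ℝ] ℝ) (u v : F) :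
    contactOperator α u v = oneFormCurl α u v + α u v • α u := rfl

/-- The Reeb vector field of a contact form. -/
def reebField (α : F → F →L[ℝ] ℝ) (u : F) : F := (contactOperator α u).inverse (α u)

/-- The contact vector field with Hamiltonian `H`. -/
def contactField (α : F → F →L[ℝ] ℝ) (H : F → ℝ) (u : F) : F :=
  H u • reebField α u + (contactOperator α u).inverse
    (fderiv ℝ H u (reebField α u) • α u - fderiv ℝ H u)

namespace IsContactFormOn

variable {α : F → F →L[ℝ] ℝ} {W : Set F} {H : F → ℝ} {u : F}

lemma contDiffAt (h : IsContactFormOn α W) (hu : u ∈ W) : ContDiffAt ℝ ∞ α u :=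
  h.contDiffOn.contDiffAt (h.isOpen.mem_nhds hu)

lemma differentiableAt (h : IsContactFormOn α W) (hu : u ∈ W) : DifferentiableAt ℝ α u :=
  (h.contDiffAt hu).differentiableAt (by simp)

/-- Evaluating the covector at `v` itself kills the skew part and leaves `(α v)²`, so `v` lies in
the kernels of both `α` and `dα`. -/
lemma contactOperator_injective (h : IsContactFormOn α W) (hu : u ∈ W) :
    Function.Injective (contactOperator α u) := by
  rw [injective_iff_map_eq_zero]
  intro v hv
  have h1 : contactOperator α u v v = 0 := by rw [hv]; rfl
  rw [contactOperator_apply] at h1 hv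
  have h2 : α u v = 0 := by simpa [oneFormCurl_self] using h1
  exact h.nondegenerate u hu v h2 (by simpa [h2] using hv)

variable [FiniteDimensional ℝ F]

lemma exists_equiv (h : IsContactFormOn α W) (hu : u ∈ W) :
    ∃ e : F ≃L[ℝ] (F →L[ℝ] ℝ), (e : F →L[ℝ] F →L[ℝ] ℝ) = contactOperator α u := by
  have hdim : Module.finrank ℝ F = Module.finrank ℝ (F →L[ℝ] ℝ) := by
    rw [← (LinearMap.toContinuousLinearMap (𝕜 := ℝ) (E := F) (F' := ℝ)).finrank_eq]
    exact (Subspace.dual_finrank_eq (K := ℝ) (V := F)).symm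
  refine ⟨(LinearMap.linearEquivOfInjective (contactOperator α u).toLinearMap
    (h.contactOperator_injective hu) hdim).toContinuousLinearEquiv, ?_⟩
  ext v w
  rfl

lemma inverse_contactOperator_apply (h : IsContactFormOn α W) (hu : u ∈ W) (v : F) :
    (contactOperator α u).inverse (contactOperator α u v) = v := by
  obtain ⟨e, he⟩ := h.exists_equiv hu
  rw [← he, ContinuousLinearMap.inverse_equiv]
  simp

lemma contactOperator_inverse_apply (h : IsContactFormOn α W) (hu : u ∈ W) (θ : F →L[ℝ] ℝ) :
    contactOperator α u ((contactOperator α u).inverse θ) = θ := by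
  obtain ⟨e, he⟩ := h.exists_equiv hu
  rw [← he, ContinuousLinearMap.inverse_equiv]
  simp

lemma reebField_spec (h : IsContactFormOn α W) (hu : u ∈ W) :
    α u (reebField α u) = 1 ∧ oneFormCurl α u (reebField α u) = 0 := by
  obtain ⟨r, hr, hr'⟩ := h.reeb u hu
  have h1 : contactOperator α u r = α u := by simp [contactOperator_apply, hr, hr']
  have h2 : reebField α u = r := by
    rw [reebField, ← h.inverse_contactOperator_apply hu r, h1]
  rw [h2]; exact ⟨hr, hr'⟩

lemma contactField_spec (h : IsContactFormOn α W) (hu : u ∈ W) :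
    α u (contactField α H u) = H u ∧ oneFormCurl α u (contactField α H u) =
      fderiv ℝ H u (reebField α u) • α u - fderiv ℝ H u := by
  obtain ⟨hr, hr'⟩ := h.reebField_spec hu
  set θ := fderiv ℝ H u (reebField α u) • α u - fderiv ℝ H u with hθ
  set Y := (contactOperator α u).inverse θ with hY
  have hTY : oneFormCurl α u Y + α u Y • α u = θ := by
    rw [← contactOperator_apply]; exact h.contactOperator_inverse_apply hu θ
  -- Evaluate at the Reeb field, where `θ` and `dα(Y, ·)` vanish and `α` equals one.
  have hαY : α u Y = 0 := by
    have h1 := congrArg (fun A : F →L[ℝ] ℝ => A (reebField α u)) hTY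
    simpa [oneFormCurl_swap α u Y, hr, hr', hθ] using h1
  have hX : contactField α H u = H u • reebField α u + Y := rfl
  rw [hX]
  constructor
  · simp [hr, hαY]
  · simpa [hr', hαY] using hTY

/-- Injectivity of `contactOperator` makes the two equations determine the vector. Evaluation at the
Reeb field forces `c` to be the derivative of `H` along it. -/
lemma contactField_eq (h : IsContactFormOn α W) (hu : u ∈ W) {v : F} {c : ℝ}
    (hv : α u v = H u) (hv' : oneFormCurl α u v = c • α u - fderiv ℝ H u) :
    contactField α H u = v := by
  obtain ⟨hr, hr'⟩ := h.reebField_spec hu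
  obtain ⟨h1, h2⟩ := h.contactField_spec (H := H) hu
  apply h.contactOperator_injective hu
  have h3 := congrArg (fun A : F →L[ℝ] ℝ => A (reebField α u)) hv'
  have hc : c = fderiv ℝ H u (reebField α u) := by
    have h4 : (0 : ℝ) = c - fderiv ℝ H u (reebField α u) := by
      simpa [oneFormCurl_swap α u v, hr, hr'] using h3
    linarith
  rw [contactOperator_apply, contactOperator_apply, h1, h2, hv, hv', hc]

/-- A vector field with `L_X α = c α` is the contact vector field of its Hamiltonian `α(X)`. -/
lemma contactField_eq_of_lieDeriv (h : IsContactFormOn α W) (hu : u ∈ W) {X : F → F} {c : ℝ}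
    (hX : DifferentiableAt ℝ X u) (hH : H =ᶠ[nhds u] fun w => α w (X w))
    (hL : ∀ v, fderiv ℝ α u (X u) v + α u (fderiv ℝ X u v) = c * α u v) :
    contactField α H u = X u := by
  refine h.contactField_eq hu (c := c) hH.self_of_nhds.symm ?_
  have h1 := ((h.differentiableAt hu).hasFDerivAt.clm_apply hX.hasFDerivAt).congr_of_eventuallyEq hH
  ext v
  have h2 := hL v
  rw [h1.fderiv]
  simp only [oneFormCurl_apply, sub_apply, add_apply,
    ContinuousLinearMap.comp_apply, ContinuousLinearMap.flip_apply, smul_apply,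
    smul_eq_mul]
  linarith

lemma contDiffOn_contactOperator (h : IsContactFormOn α W) :
    ContDiffOn ℝ ∞ (contactOperator α) W := by
  have h1 : ContDiffOn ℝ ∞ (fderiv ℝ α) W := h.contDiffOn.fderiv_of_isOpen h.isOpen le_rfl
  have h2 : ContDiffOn ℝ ∞ (fun u => (fderiv ℝ α u).flip) W := by
    rw [contDiffOn_clm_apply]
    intro v
    rw [contDiffOn_clm_apply]
    exact fun w => (h1.clm_apply contDiffOn_const).clm_apply contDiffOn_const
  have h3 : ContDiffOn ℝ ∞ (fun u => (α u).smulRight (α u)) W := by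
    rw [contDiffOn_clm_apply]
    exact fun v => (h.contDiffOn.clm_apply contDiffOn_const).smul h.contDiffOn
  exact (h1.sub h2).add h3

lemma contDiffOn_inverse (h : IsContactFormOn α W) :
    ContDiffOn ℝ ∞ (fun u => (contactOperator α u).inverse) W := by
  have : CompleteSpace F := FiniteDimensional.complete ℝ F
  intro u hu
  obtain ⟨e, he⟩ := h.exists_equiv hu
  have h1 : ContDiffAt ℝ ∞ ContinuousLinearMap.inverse (contactOperator α u) := by
    rw [← he]; exact contDiffAt_map_inverse e
  exact h1.comp_contDiffWithinAt u (h.contDiffOn_contactOperator u hu)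

lemma contDiffOn_reebField (h : IsContactFormOn α W) : ContDiffOn ℝ ∞ (reebField α) W :=
  h.contDiffOn_inverse.clm_apply h.contDiffOn

lemma contDiffOn_contactField (h : IsContactFormOn α W) (hH : ContDiff ℝ ∞ H) :
    ContDiffOn ℝ ∞ (contactField α H) W := by
  have hH' : ContDiff ℝ ∞ (fderiv ℝ H) := hH.fderiv_right le_rfl
  refine (hH.contDiffOn.smul h.contDiffOn_reebField).add (h.contDiffOn_inverse.clm_apply ?_)
  exact ((hH'.contDiffOn.clm_apply h.contDiffOn_reebField).smul h.contDiffOn).sub hH'.contDiffOn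

/-- Cartan's formula: differentiate `α(X) = H` and add the equation for `dα(X, ·)`. -/
lemma lieDeriv_contactField (h : IsContactFormOn α W) (hH : ContDiff ℝ ∞ H) (hu : u ∈ W) (v : F) :
    fderiv ℝ α u (contactField α H u) v + α u (fderiv ℝ (contactField α H) u v)
      = fderiv ℝ H u (reebField α u) * α u v := by
  have hX : DifferentiableAt ℝ (contactField α H) u :=
    ((h.contDiffOn_contactField hH).contDiffAt (h.isOpen.mem_nhds hu)).differentiableAt (by simp)
  have hHX : H =ᶠ[nhds u] fun w => α w (contactField α H w) := by
    filter_upwards [h.isOpen.mem_nhds hu] with w hw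
    exact (h.contactField_spec hw).1.symm
  have h1 := ((h.differentiableAt hu).hasFDerivAt.clm_apply hX.hasFDerivAt).congr_of_eventuallyEq
    hHX
  have h2 := congrArg (fun A : F →L[ℝ] ℝ => A v) (h.contactField_spec (H := H) hu).2
  have h3 := congrArg (fun A : F →L[ℝ] ℝ => A v) h1.fderiv
  simp only [oneFormCurl_apply, sub_apply, add_apply,
    ContinuousLinearMap.comp_apply, ContinuousLinearMap.flip_apply, smul_apply,
    smul_eq_mul] at h2 h3
  linarith

/-- A compactly supported Hamiltonian generates an infinitesimal symmetry. -/
theorem isInfinitesimalSymmetry (h : IsContactFormOn α W) (hH : ContDiff ℝ ∞ H) {C : Set F}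
    (hC : tsupport H ⊆ C) (hCW : C ⊆ W) :
    IsInfinitesimalSymmetry α C (contactField α H) := by
  have hzero : ∀ u ∉ tsupport H, contactField α H u = 0 := by
    intro u hu
    have h0 : H =ᶠ[nhds u] 0 := notMem_tsupport_iff_eventuallyEq.1 hu
    have h1 : fderiv ℝ H u = 0 := by
      rw [h0.fderiv_eq]; exact fderiv_const_apply (0 : ℝ)
    simp [contactField, h1, h0.self_of_nhds]
  refine ⟨contDiff_iff_contDiffAt.2 fun u => ?_, fun u hu => hzero u fun h' => hu (hC h'),
    fun u => fderiv ℝ H u (reebField α u), ?_, fun u hu v => h.lieDeriv_contactField hH (hCW hu) v⟩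
  · by_cases hu : u ∈ tsupport H
    · exact (h.contDiffOn_contactField hH).contDiffAt (h.isOpen.mem_nhds (hCW (hC hu)))
    · have : contactField α H =ᶠ[nhds u] fun _ => 0 := by
        filter_upwards [(isClosed_tsupport H).isOpen_compl.mem_nhds hu] with w hw
        exact hzero w hw
      exact contDiffAt_const.congr_of_eventuallyEq this
  · exact (((hH.continuous_fderiv (by simp)).continuousOn).clm_apply
      (h.contDiffOn_reebField.continuousOn.mono hCW))

/-- Every tangent vector extends to an infinitesimal symmetry supported near its base point. -/
theorem exists_isInfinitesimalSymmetry_eq (h : IsContactFormOn α W) (hu : u ∈ W) (v : F) :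
    ∃ C ⊆ W, IsCompact C ∧ ∃ V, IsInfinitesimalSymmetry α C V ∧ V u = v := by
  obtain ⟨r, hr, hball⟩ := Metric.nhds_basis_closedBall.mem_iff.1 (h.isOpen.mem_nhds hu)
  let χ : ContDiffBump u := ⟨r / 2, r, by positivity, by linarith⟩
  -- At `u` this affine Hamiltonian has value `α u v` and derivative `-dα(v, ·)`, which are the
  -- equations of `contactField_eq` for `v` with `c = 0`.
  let l : F → ℝ := fun w => α u v - oneFormCurl α u v (w - u)
  have hl : ContDiff ℝ ∞ l :=
    contDiff_const.sub ((oneFormCurl α u v).contDiff.comp (contDiff_id.sub contDiff_const))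
  have hH : ContDiff ℝ ∞ (fun w => χ w * l w) := χ.contDiff.mul hl
  refine ⟨Metric.closedBall u r, hball, isCompact_closedBall u r, contactField α fun w => χ w * l w,
    h.isInfinitesimalSymmetry hH ?_ hball, ?_⟩
  · exact (tsupport_mul_subset_left).trans χ.tsupport_eq.le
  · have hev : (fun w => χ w * l w) =ᶠ[nhds u] l := by
      filter_upwards [χ.eventuallyEq_one] with w hw
      simp [hw]
    refine h.contactField_eq hu (c := 0) ?_ ?_
    · exact (hev.self_of_nhds.trans (by simp [l])).symm
    · have h1 : HasFDerivAt l (0 - (oneFormCurl α u v).comp (ContinuousLinearMap.id ℝ F)) u :=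
        (hasFDerivAt_const _ _).sub
          ((oneFormCurl α u v).hasFDerivAt.comp u ((hasFDerivAt_id u).sub_const u))
      rw [hev.fderiv_eq, h1.fderiv]
      simp

end IsContactFormOn

end ContactHamiltonian

/-! ### Linear algebra of `a ∧ Bⁿ` in odd dimension. -/

section WedgePower

variable {F : Type*} [NormedAddCommGroup F] [NormedSpace ℝ F]

/-- The multilinear form `(v₀, …, v₂ₙ) ↦ a(v₀) ∏ i, B(v_{2i+1}, v_{2i+2})`. -/
def wedgeMultilinear {n : ℕ} (a : F →L[ℝ] ℝ) (B : F →L[ℝ] F →L[ℝ] ℝ) :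
    MultilinearMap ℝ (fun _ : Fin (2 * n + 1) => F) ℝ :=
  -- Each slot occurs in exactly one factor: slot `0` in `a`, and slot `j > 0` in the pair of index
  -- `(j - 1) / 2`.
  have key : ∀ (v : Fin (2 * n + 1) → F) (j : Fin (2 * n + 1)), ∃ l : F →L[ℝ] ℝ, ∀ x,
      a (Function.update v j x 0) * ∏ i : Fin n,
        B (Function.update v j x ⟨2 * (i : ℕ) + 1, by omega⟩)
          (Function.update v j x ⟨2 * (i : ℕ) + 2, by omega⟩) = l x := by
    intro v j
    by_cases hj : j = 0
    · subst hj
      refine ⟨(∏ i : Fin n, B (v ⟨2 * (i : ℕ) + 1, by omega⟩)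
          (v ⟨2 * (i : ℕ) + 2, by omega⟩)) • a, fun x => ?_⟩
      simp [Fin.ext_iff, mul_comm]
    · obtain ⟨i, hi⟩ : ∃ i : Fin n, (j : ℕ) = 2 * i + 1 ∨ (j : ℕ) = 2 * i + 2 := by
        have : (j : ℕ) ≠ 0 := fun h => hj (Fin.ext h)
        exact ⟨⟨((j : ℕ) - 1) / 2, by omega⟩, by simp only; omega⟩
      set c := a (v 0) * ∏ k ∈ Finset.univ.erase i, B (v ⟨2 * (k : ℕ) + 1, by omega⟩)
          (v ⟨2 * (k : ℕ) + 2, by omega⟩) with hc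
      have hrest : ∀ x, ∏ k ∈ Finset.univ.erase i,
          B (Function.update v j x ⟨2 * (k : ℕ) + 1, by omega⟩)
            (Function.update v j x ⟨2 * (k : ℕ) + 2, by omega⟩) =
          ∏ k ∈ Finset.univ.erase i, B (v ⟨2 * (k : ℕ) + 1, by omega⟩)
            (v ⟨2 * (k : ℕ) + 2, by omega⟩) := by
        intro x
        refine Finset.prod_congr rfl fun k hk => ?_
        have hk' : (k : ℕ) ≠ i := fun h => (Finset.mem_erase.1 hk).1 (Fin.ext h)
        rw [Function.update_of_ne, Function.update_of_ne] <;>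
          (rw [Ne, Fin.ext_iff]; simp only; omega)
      have h0 : ∀ x, Function.update v j x 0 = v 0 := fun x =>
        Function.update_of_ne (fun h => hj h.symm) _ _
      rcases hi with hi | hi
      · refine ⟨c • B.flip (v ⟨2 * (i : ℕ) + 2, by omega⟩), fun x => ?_⟩
        rw [← Finset.mul_prod_erase Finset.univ _ (Finset.mem_univ i), hrest, h0]
        have h1 : Function.update v j x ⟨2 * (i : ℕ) + 1, by omega⟩ = x := by
          rw [show (⟨2 * (i : ℕ) + 1, by omega⟩ : Fin (2 * n + 1)) = j from Fin.ext hi.symm,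
            Function.update_self]
        have h2 : Function.update v j x ⟨2 * (i : ℕ) + 2, by omega⟩ =
            v ⟨2 * (i : ℕ) + 2, by omega⟩ := by
          rw [Function.update_of_ne]; rw [Ne, Fin.ext_iff]; simp only; omega
        rw [h1, h2]
        simp [hc]; ring
      · refine ⟨c • B (v ⟨2 * (i : ℕ) + 1, by omega⟩), fun x => ?_⟩
        rw [← Finset.mul_prod_erase Finset.univ _ (Finset.mem_univ i), hrest, h0]
        have h1 : Function.update v j x ⟨2 * (i : ℕ) + 2, by omega⟩ = x := by
          rw [show (⟨2 * (i : ℕ) + 2, by omega⟩ : Fin (2 * n + 1)) = j from Fin.ext hi.symm,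
            Function.update_self]
        have h2 : Function.update v j x ⟨2 * (i : ℕ) + 1, by omega⟩ =
            v ⟨2 * (i : ℕ) + 1, by omega⟩ := by
          rw [Function.update_of_ne]; rw [Ne, Fin.ext_iff]; simp only; omega
        rw [h1, h2]
        simp [hc]; ring
  { toFun := fun v => a (v 0) * ∏ i : Fin n, B (v ⟨2 * (i : ℕ) + 1, by omega⟩)
      (v ⟨2 * (i : ℕ) + 2, by omega⟩)
    map_update_add' := by
      intro inst v j x y
      obtain rfl : inst = instDecidableEqFin (2 * n + 1) := Subsingleton.elim _ _
      obtain ⟨l, hl⟩ := key v j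
      rw [hl, hl, hl, map_add]
    map_update_smul' := by
      intro inst v j c x
      obtain rfl : inst = instDecidableEqFin (2 * n + 1) := Subsingleton.elim _ _
      obtain ⟨l, hl⟩ := key v j
      rw [hl, hl, map_smul] }

lemma wedgeMultilinear_apply {n : ℕ} (a : F →L[ℝ] ℝ) (B : F →L[ℝ] F →L[ℝ] ℝ)
    (v : Fin (2 * n + 1) → F) : wedgeMultilinear a B v =
      a (v 0) * ∏ i : Fin n, B (v ⟨2 * (i : ℕ) + 1, by omega⟩)
        (v ⟨2 * (i : ℕ) + 2, by omega⟩) := rfl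

/-- A vector in the kernels of `a` and of the skew form `B` annihilates `a ∧ Bⁿ`. -/
lemma wedgeMultilinear_eq_zero {n : ℕ} {a : F →L[ℝ] ℝ} {B : F →L[ℝ] F →L[ℝ] ℝ} {x : F}
    (ha : a x = 0) (hB : ∀ y, B x y = 0) (hB' : ∀ y, B y x = 0) {v : Fin (2 * n + 1) → F}
    {j : Fin (2 * n + 1)} (hj : v j = x) : wedgeMultilinear a B v = 0 := by
  rw [wedgeMultilinear_apply]
  by_cases hj0 : j = 0
  · subst hj0; rw [hj, ha, zero_mul]
  · have : (j : ℕ) ≠ 0 := fun h => hj0 (Fin.ext h)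
    obtain ⟨i, hi⟩ : ∃ i : Fin n, (j : ℕ) = 2 * i + 1 ∨ (j : ℕ) = 2 * i + 2 :=
      ⟨⟨((j : ℕ) - 1) / 2, by omega⟩, by simp only; omega⟩
    rw [Finset.prod_eq_zero (Finset.mem_univ i), mul_zero]
    rcases hi with hi | hi
    · rw [← show j = ⟨2 * (i : ℕ) + 1, by omega⟩ from Fin.ext hi, hj, hB]
    · rw [← show j = ⟨2 * (i : ℕ) + 2, by omega⟩ from Fin.ext hi, hj, hB']

/-- In dimension `2n + 1`, the antisymmetrization of `a ⊗ Bⁿ` vanishes if the kernels of `a` and `B`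
have a nonzero common vector. -/
lemma alternatization_wedgeMultilinear_eq_zero [FiniteDimensional ℝ F] {n : ℕ}
    (hF : Module.finrank ℝ F = 2 * n + 1) {a : F →L[ℝ] ℝ} {B : F →L[ℝ] F →L[ℝ] ℝ} {x : F}
    (hx : x ≠ 0) (ha : a x = 0) (hB : ∀ y, B x y = 0) (hB' : ∀ y, B y x = 0) :
    (wedgeMultilinear (n := n) a B).alternatization = 0 := by
  -- An alternating form is determined by its values on injective families from a basis containing
  -- `x`. By cardinality such a family exhausts the basis, so `x` is one of its entries.
  have hli : LinearIndepOn ℝ id ({x} : Set F) := LinearIndepOn.singleton hx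
  let b := Module.Basis.extend hli
  have hxmem : x ∈ hli.extend (subset_univ _) := hli.subset_extend _ rfl
  refine b.ext_alternating fun v hv => ?_
  have : Fintype (hli.extend (subset_univ {x})) := FiniteDimensional.fintypeBasisIndex b
  have hcard : Fintype.card (Fin (2 * n + 1)) = Fintype.card (hli.extend (subset_univ {x})) := by
    rw [← Module.finrank_eq_card_basis b, hF, Fintype.card_fin]
  obtain ⟨j, hj⟩ := ((Fintype.bijective_iff_injective_and_card v).2 ⟨hv, hcard⟩).2 ⟨x, hxmem⟩
  rw [MultilinearMap.alternatization_apply]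
  refine Finset.sum_eq_zero fun σ _ => ?_
  rw [MultilinearMap.domDomCongr_apply,
    wedgeMultilinear_eq_zero ha hB hB' (j := σ.symm j), smul_zero]
  simp only [Equiv.apply_symm_apply, hj]
  exact Module.Basis.extend_apply_self hli ⟨x, hxmem⟩

/-- A skew bilinear form in odd dimension is degenerate. -/
lemma exists_ne_zero_of_skew_of_odd [FiniteDimensional ℝ F] {n : ℕ}
    (hF : Module.finrank ℝ F = 2 * n + 1) {B : F →L[ℝ] F →L[ℝ] ℝ}
    (hB : ∀ x y, B x y = -B y x) : ∃ x ≠ 0, B x = 0 := by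
  let b : Module.Basis (Fin (2 * n + 1)) ℝ F := Module.finBasisOfFinrankEq ℝ F hF
  let A : Matrix (Fin (2 * n + 1)) (Fin (2 * n + 1)) ℝ := Matrix.of fun i j => B (b i) (b j)
  have hA : A.transpose = -A := by
    ext i j
    exact hB (b j) (b i)
  -- Here `det A = det Aᵀ = (-1)^(2n+1) det A`.
  have hdet : A.det = 0 := by
    have h1 := congrArg Matrix.det hA
    rw [Matrix.det_transpose, Matrix.det_neg, Fintype.card_fin,
      Odd.neg_one_pow ⟨n, rfl⟩] at h1
    linarith
  obtain ⟨c, hc, hcA⟩ := Matrix.exists_vecMul_eq_zero_iff.2 hdet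
  refine ⟨∑ i, c i • b i, fun h => hc ?_, ?_⟩
  · funext i
    exact Fintype.linearIndependent_iff.1 b.linearIndependent c h i
  · apply ContinuousLinearMap.coe_injective
    refine b.ext fun j => ?_
    have h1 := congrFun hcA j
    simpa [Matrix.vecMul, dotProduct, A] using h1

end WedgePower

/-! ### From the exterior product condition to contact forms. -/

section ContactModelForms

variable {n : ℕ}

lemma finrank_contactModel : Module.finrank ℝ (ContactModel n) = 2 * n + 1 := by
  simp [ContactModel, Module.finrank_prod]; ring

lemma dOneForm_apply {α : ContactModel n → ContactModel n →L[ℝ] ℝ} {u : ContactModel n}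
    (hα : DifferentiableAt ℝ α u) (x y : ContactModel n) :
    dOneForm α u ![x, y] = oneFormCurl α u x y := by
  have h1 : DifferentiableAt ℝ (fun w => ContinuousAlternatingMap.ofSubsingleton ℝ
      (ContactModel n) ℝ (0 : Fin 1) (α w)) u :=
    (ContinuousAlternatingMap.ofSubsingletonLIE (𝕜 := ℝ) (E := ContactModel n) (F := ℝ)
      (0 : Fin 1)).differentiableAt.comp u hα
  have h2 : ∀ a b : ContactModel n, fderiv ℝ (fun w => α w a) u b = fderiv ℝ α u b a := by
    intro a b
    have := hα.hasFDerivAt.clm_apply (hasFDerivAt_const a u)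
    rw [this.fderiv]; simp
  rw [dOneForm, extDeriv_apply h1, Fin.sum_univ_two, oneFormCurl_apply]
  simp [Fin.removeNth, h2, sub_eq_add_neg]

lemma wedgePow_eq {a : ContactModel n →L[ℝ] ℝ} {β : ContactModel n [⋀^Fin 2]→L[ℝ] ℝ}
    {B : ContactModel n →L[ℝ] ContactModel n →L[ℝ] ℝ} (h : ∀ x y, β ![x, y] = B x y)
    (v : Fin (2 * n + 1) → ContactModel n) :
    wedgePow a β v = (1 / 2 : ℝ) ^ n * (wedgeMultilinear (n := n) a B).alternatization v := by
  rw [wedgePow, MultilinearMap.alternatization_apply]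
  congr 1
  refine Finset.sum_congr rfl fun σ _ => ?_
  rw [MultilinearMap.domDomCongr_apply, wedgeMultilinear_apply, Units.smul_def, zsmul_eq_mul]
  simp only [h]

/-- A smooth one-form with `α ∧ (dα)ⁿ` nowhere zero is a contact form. -/
lemma isContactFormOn_of_wedgePow_ne_zero {α : ContactModel n → ContactModel n →L[ℝ] ℝ}
    {W : Set (ContactModel n)} (hW : IsOpen W) (hα : ContDiffOn ℝ ∞ α W)
    (h : ∀ u ∈ W, ∃ v, wedgePow (α u) (dOneForm α u) v ≠ 0) : IsContactFormOn α W := by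
  have hnd : ∀ u ∈ W, ∀ v, α u v = 0 → oneFormCurl α u v = 0 → v = 0 := by
    intro u hu v hv hv'
    by_contra hne
    obtain ⟨w, hw⟩ := h u hu
    apply hw
    have hd : DifferentiableAt ℝ α u :=
      (hα.contDiffAt (hW.mem_nhds hu)).differentiableAt (by simp)
    rw [wedgePow_eq (dOneForm_apply hd), alternatization_wedgeMultilinear_eq_zero
      finrank_contactModel hne hv (fun y => by rw [hv']; rfl)
      (fun y => by rw [oneFormCurl_swap, hv']; simp)]
    simp
  refine ⟨hW, hα, hnd, fun u hu => ?_⟩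
  -- In odd dimension `dα` has a nonzero kernel vector. By nondegeneracy `α` does not vanish on it,
  -- so it can be normalized to a Reeb vector.
  obtain ⟨r, hr, hr'⟩ := exists_ne_zero_of_skew_of_odd finrank_contactModel
    (oneFormCurl_swap α u)
  have hr0 : α u r ≠ 0 := fun h0 => hr (hnd u hu r h0 hr')
  exact ⟨(α u r)⁻¹ • r, by simp [hr0], by simp [hr']⟩

end ContactModelForms

/-! ### Extending coordinate maps by the identity. -/

section TransplantMap

variable {n : ℕ} {M : Type*} [TopologicalSpace M]

open Classical in
/-- The map of `M` that reads `f` in the coordinates `e` and is the identity elsewhere. -/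
def transplant (e : OpenPartialHomeomorph (ContactModel n) M) (f : ContactModel n → ContactModel n)
    (p : M) : M := if p ∈ e.target then e (f (e.symm p)) else p

variable {e : OpenPartialHomeomorph (ContactModel n) M} {f : ContactModel n ≃ ContactModel n}
  {C : Set (ContactModel n)} {α : ContactModel n → ContactModel n →L[ℝ] ℝ}

lemma transplant_apply (f : ContactModel n → ContactModel n) {u : ContactModel n}
    (hu : u ∈ e.source) : transplant e f (e u) = e (f u) := by
  rw [transplant, if_pos (e.map_source hu), e.left_inv hu]

lemma transplant_eq_self (hC : ∀ u ∉ C, f u = u) {p : M} (hp : p ∉ e '' C) :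
    transplant e f p = p := by
  rw [transplant]
  split_ifs with h
  · rw [hC _ fun h' => hp ⟨_, h', e.right_inv h⟩, e.right_inv h]
  · rfl

lemma PreservesKer.mem_source (hf : PreservesKer α C f) (hC : C ⊆ e.source) {u : ContactModel n}
    (hu : u ∈ e.source) : f u ∈ e.source := by
  by_cases h : u ∈ C
  · exact hC (hf.mem h)
  · rwa [hf.eq_self u h]

lemma transplant_symm_apply (hf : PreservesKer α C f) (hC : C ⊆ e.source) (p : M) :
    transplant e f.symm (transplant e f p) = p := by
  by_cases h : p ∈ e.target
  · rw [← e.right_inv h, transplant_apply _ (e.map_target h),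
      transplant_apply _ (hf.mem_source hC (e.map_target h)), Equiv.symm_apply_apply]
  · have h1 : ∀ g : ContactModel n → ContactModel n, transplant e g p = p := fun g => if_neg h
    rw [h1, h1]

end TransplantMap

/-! ### Contact symmetries of a manifold. -/

section ContactSymmetry

variable {n : ℕ} {M : Type*} [TopologicalSpace M] [ChartedSpace (ContactModel n) M]

local notation "𝓘ₙ" => 𝓘(ℝ, ContactModel n)

/-- `Φ` is a diffeomorphism of `M`, equal to the identity off `O`, whose differential preserves
`ξ`. -/
structure IsContactSymmetry (ξ : TangentDistribution n M) (O : Set M) (Φ : M ≃ M) : Prop where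
  contMDiff : ContMDiff 𝓘ₙ 𝓘ₙ ∞ Φ
  contMDiff_symm : ContMDiff 𝓘ₙ 𝓘ₙ ∞ Φ.symm
  eq_self : ∀ p ∉ O, Φ p = p
  map_mem : ∀ p, ∀ v ∈ ξ p, mfderiv 𝓘ₙ 𝓘ₙ Φ p v ∈ ξ (Φ p)
  map_mem_symm : ∀ p, ∀ v ∈ ξ p, mfderiv 𝓘ₙ 𝓘ₙ Φ.symm p v ∈ ξ (Φ.symm p)

lemma TangentDistribution.mem_congr (ξ : TangentDistribution n M) {p q : M} (h : p = q)
    (v : ContactModel n) : (v ∈ ξ p ↔ v ∈ ξ q) := by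
  subst h; rfl

namespace IsContactSymmetry

variable {ξ : TangentDistribution n M} {O : Set M} {Φ Ψ : M ≃ M}

lemma symm (h : IsContactSymmetry ξ O Φ) : IsContactSymmetry ξ O Φ.symm where
  contMDiff := h.contMDiff_symm
  contMDiff_symm := h.contMDiff
  eq_self p hp := by rw [Equiv.symm_apply_eq, h.eq_self p hp]
  map_mem := h.map_mem_symm
  map_mem_symm := h.map_mem

lemma mono {O' : Set M} (h : IsContactSymmetry ξ O Φ) (hO : O ⊆ O') :
    IsContactSymmetry ξ O' Φ where
  contMDiff := h.contMDiff
  contMDiff_symm := h.contMDiff_symm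
  eq_self p hp := h.eq_self p fun h' => hp (hO h')
  map_mem := h.map_mem
  map_mem_symm := h.map_mem_symm

lemma refl (ξ : TangentDistribution n M) (O : Set M) :
    IsContactSymmetry ξ O (Equiv.refl M) where
  contMDiff := contMDiff_id
  contMDiff_symm := contMDiff_id
  eq_self p _ := rfl
  map_mem p v hv := by
    have : mfderiv 𝓘ₙ 𝓘ₙ (Equiv.refl M) p = ContinuousLinearMap.id ℝ _ := mfderiv_id
    rw [this]; exact hv
  map_mem_symm p v hv := by
    have : mfderiv 𝓘ₙ 𝓘ₙ (Equiv.refl M).symm p = ContinuousLinearMap.id ℝ _ := mfderiv_id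
    rw [this]; exact hv

lemma map_mem_comp (h : IsContactSymmetry ξ O Φ) (h' : IsContactSymmetry ξ O Ψ) (p : M)
    (v : TangentSpace 𝓘ₙ p) (hv : v ∈ ξ p) :
    mfderiv 𝓘ₙ 𝓘ₙ (Ψ ∘ Φ) p v ∈ ξ (Ψ (Φ p)) := by
  rw [mfderiv_comp p (h'.contMDiff.mdifferentiableAt (by simp))
    (h.contMDiff.mdifferentiableAt (by simp))]
  exact h'.map_mem _ _ (h.map_mem _ _ hv)

lemma trans (h : IsContactSymmetry ξ O Φ) (h' : IsContactSymmetry ξ O Ψ) :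
    IsContactSymmetry ξ O (Φ.trans Ψ) where
  contMDiff := h'.contMDiff.comp h.contMDiff
  contMDiff_symm := h.contMDiff_symm.comp h'.contMDiff_symm
  eq_self p hp := by rw [Equiv.trans_apply, h.eq_self p hp, h'.eq_self p hp]
  map_mem := h.map_mem_comp h'
  map_mem_symm := h'.symm.map_mem_comp h.symm

/-- The homeomorphism underlying a contact symmetry. -/
def toHomeomorph (h : IsContactSymmetry ξ O Φ) : M ≃ₜ M where
  toEquiv := Φ
  continuous_toFun := h.contMDiff.continuous
  continuous_invFun := h.contMDiff_symm.continuous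

lemma mfderiv_symm_apply (h : IsContactSymmetry ξ O Φ) (p : M) (v : TangentSpace 𝓘ₙ p) :
    mfderiv 𝓘ₙ 𝓘ₙ Φ.symm (Φ p) (mfderiv 𝓘ₙ 𝓘ₙ Φ p v) = v := by
  have h1 := mfderiv_comp p (h.contMDiff_symm.mdifferentiableAt (x := Φ p) (by simp))
    (h.contMDiff.mdifferentiableAt (x := p) (by simp))
  have h2 : (Φ.symm ∘ Φ : M → M) = id := funext Φ.symm_apply_apply
  rw [h2, mfderiv_id] at h1
  exact (congrArg (fun A => A v) h1).symm

lemma mem_iff (h : IsContactSymmetry ξ O Φ) (p : M) (v : TangentSpace 𝓘ₙ p) :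
    mfderiv 𝓘ₙ 𝓘ₙ Φ p v ∈ ξ (Φ p) ↔ v ∈ ξ p := by
  refine ⟨fun hv => ?_, h.map_mem p v⟩
  have h1 := h.map_mem_symm _ _ hv
  rw [h.mfderiv_symm_apply] at h1
  exact (ξ.mem_congr (Φ.symm_apply_apply p) v).1 h1

lemma isDarbouxChart (h : IsContactSymmetry ξ O Φ) {φ : OpenPartialHomeomorph (ContactModel n) M}
    (hφ : IsDarbouxChart ξ φ) :
    IsDarbouxChart ξ (φ.transHomeomorph h.toHomeomorph) where
  contMDiffOn := h.contMDiff.comp_contMDiffOn hφ.contMDiffOn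
  contMDiffOn_symm := hφ.contMDiffOn_symm.comp h.contMDiff_symm.contMDiffOn fun p hp => hp
  pullback_eq u hu := by
    rw [← hφ.pullback_eq u hu]
    have hd : MDifferentiableAt 𝓘ₙ 𝓘ₙ φ u :=
      (hφ.contMDiffOn.contMDiffAt (φ.open_source.mem_nhds hu)).mdifferentiableAt (by simp)
    ext v
    have h1 := mfderiv_comp u (h.contMDiff.mdifferentiableAt (x := φ u) (by simp)) hd
    change mfderiv 𝓘ₙ 𝓘ₙ (Φ ∘ φ) u v ∈ ξ (Φ (φ u)) ↔ mfderiv 𝓘ₙ 𝓘ₙ φ u v ∈ ξ (φ u)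
    rw [h1]
    exact h.mem_iff _ _

/-- Composing the chart with `Φ` leaves its domain unchanged. The image `Φ(B)` is written as a
preimage under `Φ.symm`. -/
lemma isContactBall (h : IsContactSymmetry ξ O Φ) {B : Set M} (hB : IsContactBall ξ B) :
    IsContactBall ξ (Φ.symm ⁻¹' B) := by
  obtain ⟨φ, hφ, hs, rfl⟩ := hB
  exact ⟨_, h.isDarbouxChart hφ, hs, rfl⟩

end IsContactSymmetry

section Transplant

variable {e : OpenPartialHomeomorph (ContactModel n) M} {f : ContactModel n ≃ ContactModel n}
  {C : Set (ContactModel n)} {α : ContactModel n → ContactModel n →L[ℝ] ℝ}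

/-- Since `M` is Hausdorff, the compact set `e '' C` is closed, so the map is the identity near
every point outside `e.target`. On the open set `e.target` it is `e ∘ f ∘ e.symm`. -/
lemma contMDiff_transplant [T2Space M]
    (he : ContMDiffOn 𝓘ₙ 𝓘ₙ ∞ e e.source) (he' : ContMDiffOn 𝓘ₙ 𝓘ₙ ∞ e.symm e.target)
    (hf : PreservesKer α C f) (hC : IsCompact C) (hCe : C ⊆ e.source) :
    ContMDiff 𝓘ₙ 𝓘ₙ ∞ (transplant e f) := by
  intro p
  by_cases hp : p ∈ e.target
  · have h1 : ContMDiffAt 𝓘ₙ 𝓘ₙ ∞ (e ∘ f ∘ e.symm) p := by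
      have h2 : ContMDiffAt 𝓘ₙ 𝓘ₙ ∞ (f ∘ e.symm) p :=
        (hf.contDiff.contMDiff _).comp p (he'.contMDiffAt (e.open_target.mem_nhds hp))
      have h3 : ContMDiffAt 𝓘ₙ 𝓘ₙ ∞ e (f (e.symm p)) :=
        he.contMDiffAt (e.open_source.mem_nhds (hf.mem_source hCe (e.map_target hp)))
      exact h3.comp p h2
    refine h1.congr_of_eventuallyEq ?_
    filter_upwards [e.open_target.mem_nhds hp] with q hq
    exact if_pos hq
  · have hK : IsCompact (e '' C) := hC.image_of_continuousOn (e.continuousOn.mono hCe)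
    have hp' : p ∉ e '' C := by
      rintro ⟨u, hu, rfl⟩
      exact hp (e.map_source (hCe hu))
    refine contMDiffAt_id.congr_of_eventuallyEq ?_
    filter_upwards [hK.isClosed.isOpen_compl.mem_nhds hp'] with q hq
    exact transplant_eq_self hf.eq_self hq

/-- Over `e '' C` the differential is that of `f` read in the chart, where `ξ` is the kernel of `α`.
Near any other point the map is the identity, so `α` has to describe `ξ` only on `C`. -/
lemma mfderiv_transplant_mem [T2Space M] {ξ : TangentDistribution n M}
    (he : ContMDiffOn 𝓘ₙ 𝓘ₙ ∞ e e.source) (he' : ContMDiffOn 𝓘ₙ 𝓘ₙ ∞ e.symm e.target)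
    (hf : PreservesKer α C f) (hC : IsCompact C) (hCe : C ⊆ e.source)
    (hξ : ∀ u ∈ C, pullbackDistribution ξ e u = LinearMap.ker (α u).toLinearMap)
    (p : M) (v : TangentSpace 𝓘ₙ p) (hv : v ∈ ξ p) :
    mfderiv 𝓘ₙ 𝓘ₙ (transplant e f) p v ∈ ξ (transplant e f p) := by
  by_cases hp : p ∈ e '' C
  · obtain ⟨u, hu, rfl⟩ := hp
    have hus := hCe hu
    have hfu := hf.mem hu
    have hde : MDifferentiableAt 𝓘ₙ 𝓘ₙ e u :=
      (he.contMDiffAt (e.open_source.mem_nhds hus)).mdifferentiableAt (by simp)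
    have hde' : MDifferentiableAt 𝓘ₙ 𝓘ₙ e.symm (e u) :=
      (he'.contMDiffAt (e.open_target.mem_nhds (e.map_source hus))).mdifferentiableAt (by simp)
    have hdf : MDifferentiableAt 𝓘ₙ 𝓘ₙ f u :=
      (hf.contDiff.contMDiff u).mdifferentiableAt (by simp)
    have hdef : MDifferentiableAt 𝓘ₙ 𝓘ₙ e (f u) :=
      (he.contMDiffAt (e.open_source.mem_nhds (hCe hfu))).mdifferentiableAt (by simp)
    have hdT : MDifferentiableAt 𝓘ₙ 𝓘ₙ (transplant e f) (e u) :=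
      (contMDiff_transplant he he' hf hC hCe).mdifferentiableAt (by simp)
    have hev : (transplant e f ∘ e) =ᶠ[nhds u] (e ∘ f) := by
      filter_upwards [e.open_source.mem_nhds hus] with w hw
      exact transplant_apply f hw
    have h1 := hev.mfderiv_eq (I := 𝓘ₙ) (I' := 𝓘ₙ)
    have hid : (e ∘ e.symm) =ᶠ[nhds (e u)] id := by
      filter_upwards [e.open_target.mem_nhds (e.map_source hus)] with q hq
      exact e.right_inv hq
    have h2 := hid.mfderiv_eq (I := 𝓘ₙ) (I' := 𝓘ₙ)
    have h3 : ∀ u', u' = u → ∀ w : ContactModel n, mfderiv 𝓘ₙ 𝓘ₙ e u' w = mfderiv 𝓘ₙ 𝓘ₙ e u w := by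
      rintro u' rfl w; rfl
    rw [mfderiv_comp (e u) (by rwa [e.left_inv hus]) hde', mfderiv_id] at h2
    set w : ContactModel n := mfderiv 𝓘ₙ 𝓘ₙ e.symm (e u) v with hw
    have hwv : mfderiv 𝓘ₙ 𝓘ₙ e u w = v :=
      (h3 _ (e.left_inv hus) w).symm.trans (congrArg (fun A => A v) h2)
    rw [mfderiv_comp u hdT hde, mfderiv_comp u hdef hdf] at h1
    have h4 : mfderiv 𝓘ₙ 𝓘ₙ (transplant e f) (e u) v =
        mfderiv 𝓘ₙ 𝓘ₙ e (f u) (fderiv ℝ f u w) := by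
      have h5 := congrArg (fun A : ContactModel n →L[ℝ] ContactModel n => A w) h1
      rw [← hwv, ← mfderiv_eq_fderiv]
      exact h5
    have h6 : w ∈ pullbackDistribution ξ e u := by
      change mfderiv 𝓘ₙ 𝓘ₙ e u w ∈ ξ (e u)
      rw [hwv]; exact hv
    rw [hξ u hu] at h6
    have h7 : fderiv ℝ f u w ∈ pullbackDistribution ξ e (f u) := by
      rw [hξ _ hfu]
      exact hf.map_ker u hu w h6
    refine (ξ.mem_congr (transplant_apply f hus) _).2 ?_
    rw [h4]
    exact h7
  · have hK : IsCompact (e '' C) := hC.image_of_continuousOn (e.continuousOn.mono hCe)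
    have hev : transplant e f =ᶠ[nhds p] id := by
      filter_upwards [hK.isClosed.isOpen_compl.mem_nhds hp] with q hq
      exact transplant_eq_self hf.eq_self hq
    have h1 : mfderiv 𝓘ₙ 𝓘ₙ (transplant e f) p v = v := by
      have := hev.mfderiv_eq (I := 𝓘ₙ) (I' := 𝓘ₙ)
      rw [this, mfderiv_id]; rfl
    refine (ξ.mem_congr hev.self_of_nhds _).2 ?_
    rw [h1]
    exact hv

/-- A diffeomorphism of a coordinate domain that preserves the contact structure and is compactly
supported extends by the identity to the whole manifold. -/
theorem exists_isContactSymmetry [T2Space M] {ξ : TangentDistribution n M}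
    (he : ContMDiffOn 𝓘ₙ 𝓘ₙ ∞ e e.source) (he' : ContMDiffOn 𝓘ₙ 𝓘ₙ ∞ e.symm e.target)
    (hf : PreservesKer α C f) (hC : IsCompact C) (hCe : C ⊆ e.source)
    (hξ : ∀ u ∈ C, pullbackDistribution ξ e u = LinearMap.ker (α u).toLinearMap) :
    ∃ Φ : M ≃ M, IsContactSymmetry ξ (e '' C) Φ ∧ ∀ u ∈ e.source, Φ (e u) = e (f u) :=
  ⟨⟨transplant e f, transplant e f.symm, transplant_symm_apply hf hCe,
      transplant_symm_apply hf.symm hCe⟩,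
    { contMDiff := contMDiff_transplant he he' hf hC hCe
      contMDiff_symm := contMDiff_transplant he he' hf.symm hC hCe
      eq_self := fun _ hp => transplant_eq_self hf.eq_self hp
      map_mem := mfderiv_transplant_mem he he' hf hC hCe hξ
      map_mem_symm := mfderiv_transplant_mem he he' hf.symm hC hCe hξ },
    fun _ hu => transplant_apply f hu⟩

end Transplant

end ContactSymmetry

/-! ### Dilations and translations of the standard model. -/

section StandardModel

variable {n : ℕ}

lemma stdContactForm_apply (u v : ContactModel n) :
    stdContactForm n u v = v.2.2 + ∑ i, u.1 i * v.2.1 i := by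
  simp [stdContactForm]

lemma mem_stdContactStructure {u v : ContactModel n} :
    v ∈ stdContactStructure n u ↔ stdContactForm n u v = 0 := Iff.rfl

lemma contDiff_stdContactForm : ContDiff ℝ ∞ (stdContactForm n) := by
  rw [contDiff_clm_apply_iff]
  intro v
  simp only [stdContactForm_apply]
  fun_prop

lemma fderiv_stdContactForm_apply (u v w : ContactModel n) :
    fderiv ℝ (stdContactForm n) u v w = ∑ i, v.1 i * w.2.1 i := by
  have hd : DifferentiableAt ℝ (stdContactForm n) u :=
    contDiff_stdContactForm.differentiable (by simp) u
  have h1 := (hd.hasFDerivAt.clm_apply (hasFDerivAt_const w u)).fderiv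
  have h2 : HasFDerivAt (fun u : ContactModel n => w.2.2 + ∑ i, u.1 i * w.2.1 i) _ u :=
    (HasFDerivAt.fun_sum fun i (_ : i ∈ Finset.univ) =>
      ((ContinuousLinearMap.proj i : (Fin n → ℝ) →L[ℝ] ℝ) ∘L
        ContinuousLinearMap.fst ℝ (Fin n → ℝ) ((Fin n → ℝ) × ℝ)).hasFDerivAt.mul_const
          (w.2.1 i)).const_add w.2.2
  simp only [stdContactForm_apply] at h1
  have h3 := congrArg (fun A : ContactModel n →L[ℝ] ℝ => A v) (h1.symm.trans h2.fderiv)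
  simpa [mul_comm] using h3

lemma isContactFormOn_stdContactForm : IsContactFormOn (stdContactForm n) univ where
  isOpen := isOpen_univ
  contDiffOn := contDiff_stdContactForm.contDiffOn
  nondegenerate u _ v hv hv' := by
    have h1 : ∀ w : ContactModel n, ∑ i, v.1 i * w.2.1 i - ∑ i, w.1 i * v.2.1 i = 0 := by
      intro w
      have := congrArg (fun A : ContactModel n →L[ℝ] ℝ => A w) hv'
      simpa [oneFormCurl_apply, fderiv_stdContactForm_apply] using this
    have hx : v.1 = 0 := by
      funext i
      have := h1 (0, Pi.single i 1, 0)
      simpa [Pi.single_apply] using this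
    have hy : v.2.1 = 0 := by
      funext i
      have := h1 (Pi.single i 1, 0, 0)
      simpa [Pi.single_apply] using this
    rw [stdContactForm_apply, hy] at hv
    have hz : v.2.2 = 0 := by simpa using hv
    exact Prod.ext hx (Prod.ext hy hz)
  reeb u _ := by
    refine ⟨(0, 0, 1), by simp [stdContactForm_apply], ?_⟩
    refine ContinuousLinearMap.ext fun w => ?_
    simp [oneFormCurl_apply, fderiv_stdContactForm_apply]

/-- The generator `(x, y, z) ↦ (x, y, 2z)` of the contact dilations. -/
def eulerField (n : ℕ) : ContactModel n →L[ℝ] ContactModel n :=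
  (ContinuousLinearMap.id ℝ (Fin n → ℝ)).prodMap
    ((ContinuousLinearMap.id ℝ (Fin n → ℝ)).prodMap ((2 : ℝ) • ContinuousLinearMap.id ℝ ℝ))

@[simp] lemma eulerField_apply (u : ContactModel n) :
    eulerField n u = (u.1, u.2.1, 2 * u.2.2) := rfl

/-- The standard contact structure has, for each radius, an infinitesimal symmetry with compact
support that contracts the ball of that radius. -/
lemma exists_isInfinitesimalSymmetry_contracting (n : ℕ) {R : ℝ} (hR : 0 < R) :
    ∃ C : Set (ContactModel n), IsCompact C ∧ ∃ V,
      IsInfinitesimalSymmetry (stdContactForm n) C V ∧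
      ∀ u ∈ Metric.closedBall 0 R, V u = -eulerField n u := by
  let χ : ContDiffBump (0 : ContactModel n) := ⟨R + 1, R + 2, by positivity, by linarith⟩
  let h : ContactModel n → ℝ := fun u => stdContactForm n u (-eulerField n u)
  have hh : ContDiff ℝ ∞ h := contDiff_stdContactForm.clm_apply (eulerField n).contDiff.neg
  have hH : ContDiff ℝ ∞ fun u => χ u * h u := χ.contDiff.mul hh
  refine ⟨Metric.closedBall 0 (R + 2), isCompact_closedBall _ _, _,
    isContactFormOn_stdContactForm.isInfinitesimalSymmetry hH
      ((tsupport_mul_subset_left).trans χ.tsupport_eq.le) (subset_univ _), fun u hu => ?_⟩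
  -- The constant is `-2` because the dilations scale `z`, and with it the whole form, with weight
  -- two.
  refine isContactFormOn_stdContactForm.contactField_eq_of_lieDeriv (mem_univ u) (c := -2)
    (X := fun u => -eulerField n u) (eulerField n).differentiableAt.neg ?_ fun v => ?_
  · have hu' : u ∈ Metric.ball (0 : ContactModel n) (R + 1) :=
      Metric.closedBall_subset_ball (by linarith) hu
    filter_upwards [Metric.isOpen_ball.mem_nhds hu'] with w hw
    rw [χ.one_of_mem_closedBall (Metric.ball_subset_closedBall hw), one_mul]
  · have h1 : fderiv ℝ (fun u => -eulerField n u) u = -eulerField n :=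
      (eulerField n).hasFDerivAt.neg.fderiv
    rw [h1, fderiv_stdContactForm_apply]
    simp only [neg_apply, eulerField_apply, map_neg, stdContactForm_apply, Prod.fst_neg,
      Pi.neg_apply, neg_mul, Finset.sum_neg_distrib]
    ring

lemma norm_exp_euler_le {c : ℝ} (hc : 0 ≤ c) (u : ContactModel n) :
    ‖((Real.exp (-c) • u.1, Real.exp (-c) • u.2.1, Real.exp (-2 * c) * u.2.2) : ContactModel n)‖
      ≤ Real.exp (-c) * ‖u‖ := by
  have h1 : ‖u.1‖ ≤ ‖u‖ := norm_fst_le u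
  have h2 : ‖u.2.1‖ ≤ ‖u‖ := (norm_fst_le u.2).trans (norm_snd_le u)
  have h3 : ‖u.2.2‖ ≤ ‖u‖ := (norm_snd_le u.2).trans (norm_snd_le u)
  have h4 : Real.exp (-2 * c) ≤ Real.exp (-c) := Real.exp_le_exp.2 (by linarith)
  simp only [Prod.norm_def, norm_smul, norm_mul, Real.norm_eq_abs, Real.abs_exp] at h1 h2 h3 ⊢
  refine max_le ?_ (max_le ?_ ?_)
  · exact mul_le_mul_of_nonneg_left h1 (Real.exp_pos _).le
  · exact mul_le_mul_of_nonneg_left h2 (Real.exp_pos _).le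
  · exact mul_le_mul h4 h3 (abs_nonneg _) (Real.exp_pos _).le

/-- A compactly supported contactomorphism of the standard model that contracts a given ball. -/
lemma exists_preservesKer_contracting (n : ℕ) {R : ℝ} (hR : 0 < R) :
    ∃ C : Set (ContactModel n), IsCompact C ∧ ∃ f : ContactModel n ≃ ContactModel n,
      PreservesKer (stdContactForm n) C f ∧ ∃ c < 1, 0 ≤ c ∧
      ∀ u ∈ Metric.closedBall 0 R, ‖f u‖ ≤ c * ‖u‖ := by
  obtain ⟨C, hC, V, hV, hVe⟩ := exists_isInfinitesimalSymmetry_contracting n hR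
  obtain ⟨c, hc, K, hK, φ, hφ, hf⟩ := hV.exists_flow hC
    fun u _ => contDiff_stdContactForm.differentiable (by simp) u
  have h1 : (1 : ℝ) ∈ Icc (0 : ℝ) 1 := right_mem_Icc.2 zero_le_one
  obtain ⟨f, hfφ, hfC⟩ := hf 1 h1
  refine ⟨C, hC, f, hfC, Real.exp (-c), by simpa using hc, (Real.exp_pos _).le, fun u hu => ?_⟩
  -- The explicit orbit of `-c • eulerField n` through `u`. It stays in the ball where the cut-off
  -- field agrees with this one, so it is an orbit of the flow `φ`.
  let γ : ℝ → ContactModel n := fun t =>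
    (Real.exp (-(c * t)) • u.1, Real.exp (-(c * t)) • u.2.1, Real.exp (-2 * (c * t)) * u.2.2)
  have hγ : ∀ t, 0 ≤ t → γ t ∈ Metric.closedBall (0 : ContactModel n) R := by
    intro t ht
    rw [mem_closedBall_zero_iff] at hu ⊢
    refine (norm_exp_euler_le (by positivity) u).trans
      ((mul_le_of_le_one_left (norm_nonneg u) ?_).trans hu)
    rw [Real.exp_le_one_iff]
    have : 0 ≤ c * t := by positivity
    linarith
  have hγ0 : γ 0 = u := by simp [γ]
  have key : φ 1 (γ 0) = γ 1 := by
    refine hφ.eq_of_solution hK h1 fun s hs => ?_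
    have h2 : (c • V) (γ s) = -(c • eulerField n (γ s)) := by
      rw [Pi.smul_apply, hVe _ (hγ s hs.1), smul_neg]
    rw [h2]
    have he : ∀ a : ℝ, HasDerivAt (fun t => Real.exp (a * (c * t)))
        (Real.exp (a * (c * s)) * (a * c)) s := by
      intro a
      have := (((hasDerivAt_id s).const_mul c).const_mul a).exp
      simpa using this
    have he1 : HasDerivAt (fun t => Real.exp (-(c * t))) (Real.exp (-(c * s)) * -c) s := by
      simpa using he (-1)
    refine HasDerivAt.hasDerivWithinAt ?_
    have h3 := (he1.smul_const u.1).prodMk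
      ((he1.smul_const u.2.1).prodMk ((he (-2)).mul_const u.2.2))
    convert! h3 using 1
    refine Prod.ext ?_ (Prod.ext ?_ ?_)
    · simp only [γ, eulerField_apply, Prod.smul_fst, smul_smul, ← neg_smul]
      congr 1; ring
    · simp only [γ, eulerField_apply, Prod.smul_fst, Prod.smul_snd, smul_smul,
        ← neg_smul]
      congr 1; ring
    · simp only [γ, eulerField_apply, Prod.snd_neg, Prod.smul_snd, smul_eq_mul]
      ring
  rw [hfφ]
  rw [hγ0] at key
  rw [key]
  simpa [γ] using norm_exp_euler_le hc.le u

/-- The linear shear `(x, y, z) ↦ (x, y, z - ∑ i, aᵢ yᵢ)`. -/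
def heisenbergShear (a : Fin n → ℝ) : ContactModel n →L[ℝ] ContactModel n :=
  (ContinuousLinearMap.fst ℝ (Fin n → ℝ) ((Fin n → ℝ) × ℝ)).prod
    (((ContinuousLinearMap.fst ℝ (Fin n → ℝ) ℝ) ∘L ContinuousLinearMap.snd ℝ (Fin n → ℝ) _).prod
      (stdContactForm n (-a, 0, 0)))

lemma heisenbergShear_apply (a : Fin n → ℝ) (u : ContactModel n) :
    heisenbergShear a u = (u.1, u.2.1, u.2.2 - ∑ i, a i * u.2.1 i) := by
  simp [heisenbergShear, stdContactForm_apply, sub_eq_add_neg]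

/-- The left translation by `b` of the Heisenberg group structure on the standard model. -/
def heisenbergTranslation (b : ContactModel n) : ContactModel n ≃ₜ ContactModel n where
  toFun u := heisenbergShear b.1 u + b
  invFun u := heisenbergShear (-b.1) (u - b)
  left_inv u := by simp [heisenbergShear_apply]
  right_inv u := by ext <;> simp [heisenbergShear_apply]
  continuous_toFun := by fun_prop
  continuous_invFun := by fun_prop

lemma heisenbergTranslation_apply (b u : ContactModel n) :
    heisenbergTranslation b u = heisenbergShear b.1 u + b := rfl

/-- Translating `x` adds `∑ bᵢ dyᵢ` to the form and the shear of `z` subtracts it, so the form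
itself is preserved, not only its kernel. -/
lemma stdContactForm_heisenbergTranslation (b u v : ContactModel n) :
    stdContactForm n (heisenbergTranslation b u) (fderiv ℝ (heisenbergTranslation b) u v)
      = stdContactForm n u v := by
  have h1 : fderiv ℝ (heisenbergTranslation b) u = heisenbergShear b.1 :=
    ((heisenbergShear b.1).hasFDerivAt.add_const b).fderiv
  rw [h1, stdContactForm_apply, stdContactForm_apply, heisenbergTranslation_apply]
  simp only [heisenbergShear_apply, Prod.fst_add, Pi.add_apply, add_mul, Finset.sum_add_distrib]
  ring

end StandardModel

/-! ### Charts of contact balls and squeezing of compact sets. -/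

section ContactBalls

variable {n : ℕ} {M : Type*} [TopologicalSpace M] [ChartedSpace (ContactModel n) M]
  {ξ : TangentDistribution n M}

local notation "𝓘ₙ" => 𝓘(ℝ, ContactModel n)

lemma IsContactSymmetry.pow {O : Set M} {Φ : Equiv.Perm M} (h : IsContactSymmetry ξ O Φ) (m : ℕ) :
    IsContactSymmetry ξ O (Φ ^ m) := by
  induction m with
  | zero => exact IsContactSymmetry.refl ξ O
  | succ m ih => rw [pow_succ]; exact h.trans ih

/-- Precomposition of a Darboux chart with a local contactomorphism of the standard model. -/
lemma IsDarbouxChart.precomp {φ : OpenPartialHomeomorph (ContactModel n) M}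
    (hφ : IsDarbouxChart ξ φ) {χ : OpenPartialHomeomorph (ContactModel n) (ContactModel n)}
    (hχ : ContDiffOn ℝ ∞ χ χ.source) (hχ' : ContDiffOn ℝ ∞ χ.symm χ.target)
    (hker : ∀ u ∈ χ.source, ∀ v, stdContactForm n (χ u) (fderiv ℝ χ u v) = 0 ↔
      stdContactForm n u v = 0) : IsDarbouxChart ξ (χ.trans φ) where
  contMDiffOn := by
    refine hφ.contMDiffOn.comp (hχ.contMDiffOn.mono ?_) ?_
    · exact fun u hu => hu.1
    · exact fun u hu => hu.2
  contMDiffOn_symm := by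
    refine hχ'.contMDiffOn.comp (hφ.contMDiffOn_symm.mono ?_) ?_
    · exact fun p hp => hp.1
    · exact fun p hp => hp.2
  pullback_eq u hu := by
    have hu1 : u ∈ χ.source := hu.1
    have hu2 : χ u ∈ φ.source := hu.2
    have hd : MDifferentiableAt 𝓘ₙ 𝓘ₙ φ (χ u) :=
      (hφ.contMDiffOn.contMDiffAt (φ.open_source.mem_nhds hu2)).mdifferentiableAt (by simp)
    have hd' : MDifferentiableAt 𝓘ₙ 𝓘ₙ χ u :=
      (hχ.contDiffAt (χ.open_source.mem_nhds hu1)).contMDiffAt.mdifferentiableAt (by simp)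
    have h1 := mfderiv_comp u hd hd'
    ext v
    change mfderiv 𝓘ₙ 𝓘ₙ (φ ∘ χ) u v ∈ ξ (φ (χ u)) ↔ stdContactForm n u v = 0
    rw [h1, ← hker u hu1 v, mfderiv_eq_fderiv]
    have h2 : fderiv ℝ χ u v ∈ pullbackDistribution ξ φ (χ u) ↔
        stdContactForm n (χ u) (fderiv ℝ χ u v) = 0 := by
      rw [hφ.pullback_eq _ hu2]; rfl
    exact h2

/-- The inverse contactomorphism parametrizes `U` by the whole model. Equality of image hyperplanes
becomes a pointwise equivalence, as precomposition of Darboux charts requires. -/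
lemma AreContactomorphic.exists_symm {U : Set (ContactModel n)}
    (h : AreContactomorphic U (univ : Set (ContactModel n))) :
    ∃ χ : OpenPartialHomeomorph (ContactModel n) (ContactModel n),
      χ.source = univ ∧ χ.target = U ∧ ContDiffOn ℝ ∞ χ χ.source ∧
      ContDiffOn ℝ ∞ χ.symm χ.target ∧
      ∀ u ∈ χ.source, ∀ v, stdContactForm n (χ u) (fderiv ℝ χ u v) = 0 ↔
        stdContactForm n u v = 0 := by
  obtain ⟨ψ, rfl, ht, hψ, hψ', hker⟩ := h
  rw [← ht] at hψ'
  refine ⟨ψ.symm, ht, rfl, hψ', hψ, fun w hw v => ?_⟩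
  have hw' : w ∈ ψ.target := hw
  have hu := ψ.map_target hw'
  have hd : DifferentiableAt ℝ ψ (ψ.symm w) :=
    (hψ.contDiffAt (ψ.open_source.mem_nhds hu)).differentiableAt (by simp)
  have hd' : DifferentiableAt ℝ ψ.symm w :=
    (hψ'.contDiffAt (ψ.open_target.mem_nhds hw')).differentiableAt (by simp)
  have h1 : fderiv ℝ ψ (ψ.symm w) ∘L fderiv ℝ ψ.symm w = ContinuousLinearMap.id ℝ _ := by
    rw [← fderiv_comp w hd hd', ← fderiv_id (x := w)]
    refine Filter.EventuallyEq.fderiv_eq ?_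
    filter_upwards [ψ.open_target.mem_nhds hw'] with x hx using ψ.right_inv hx
  have h2 : fderiv ℝ ψ.symm w ∘L fderiv ℝ ψ (ψ.symm w) = ContinuousLinearMap.id ℝ _ := by
    have hd'' : DifferentiableAt ℝ ψ.symm (ψ (ψ.symm w)) := by rwa [ψ.right_inv hw']
    have := fderiv_comp (ψ.symm w) hd'' hd
    rw [ψ.right_inv hw'] at this
    rw [← this, ← fderiv_id (x := ψ.symm w)]
    refine Filter.EventuallyEq.fderiv_eq ?_
    filter_upwards [ψ.open_source.mem_nhds hu] with x hx using ψ.left_inv hx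
  have h1v : ∀ v, fderiv ℝ ψ (ψ.symm w) (fderiv ℝ ψ.symm w v) = v :=
    fun v => congrArg (fun A : ContactModel n →L[ℝ] ContactModel n => A v) h1
  have h2v : ∀ v, fderiv ℝ ψ.symm w (fderiv ℝ ψ (ψ.symm w) v) = v :=
    fun v => congrArg (fun A : ContactModel n →L[ℝ] ContactModel n => A v) h2
  have hk := hker _ hu
  rw [ψ.right_inv hw'] at hk
  constructor
  · intro hv
    have h3 : fderiv ℝ ψ (ψ.symm w) (fderiv ℝ ψ.symm w v) ∈
        (stdContactStructure n (ψ.symm w)).map (fderiv ℝ ψ (ψ.symm w)).toLinearMap :=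
      Submodule.mem_map_of_mem (f := (fderiv ℝ ψ (ψ.symm w)).toLinearMap)
        (mem_stdContactStructure.2 hv)
    rw [hk, h1v] at h3
    exact h3
  · intro hv
    have h3 : v ∈ stdContactStructure n w := hv
    rw [← hk] at h3
    obtain ⟨v', hv', rfl⟩ := h3
    change stdContactForm n (ψ.symm w) (fderiv ℝ ψ.symm w (fderiv ℝ ψ (ψ.symm w) v')) = 0
    rw [h2v]
    exact hv'

/-- A contact ball is the image of a Darboux chart defined on the whole standard model and centred
at any given point of the ball. -/
lemma IsContactBall.exists_centered_chart {B : Set M} (hB : IsContactBall ξ B) {q : M}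
    (hq : q ∈ B) : ∃ φ : OpenPartialHomeomorph (ContactModel n) M, IsDarbouxChart ξ φ ∧
      φ.source = univ ∧ φ.target = B ∧ φ 0 = q := by
  obtain ⟨φ, hφ, hs, rfl⟩ := hB
  obtain ⟨χ, hχs, hχt, hχ, hχ', hker⟩ := hs.exists_symm
  have h1 := hφ.precomp hχ hχ' hker
  -- The chart `φ ∘ χ` sends `b` to `q`, so translating the origin to `b` centres it at `q`.
  let b : ContactModel n := χ.symm (φ.symm q)
  let τ := (heisenbergTranslation b).toOpenPartialHomeomorph
  have hτ : ContDiff ℝ ∞ (heisenbergTranslation b) :=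
    (heisenbergShear b.1).contDiff.add contDiff_const
  have hτ' : ContDiff ℝ ∞ (heisenbergTranslation b).symm :=
    (heisenbergShear (-b.1)).contDiff.comp (contDiff_id.sub contDiff_const)
  have h2 := h1.precomp (χ := τ) hτ.contDiffOn hτ'.contDiffOn
    fun u _ v => by
      rw [show stdContactForm n (τ u) (fderiv ℝ τ u v) = stdContactForm n u v from
        stdContactForm_heisenbergTranslation b u v]
  have hqs : φ.symm q ∈ χ.target := by rw [hχt]; exact φ.map_target hq
  refine ⟨_, h2, ?_, ?_, ?_⟩
  · ext u
    have h3 : χ (τ u) ∈ φ.source := by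
      rw [← hχt]; exact χ.map_source (by rw [hχs]; trivial)
    simp [hχs, τ] at h3 ⊢
    exact h3
  · ext p
    have h3 : p ∈ φ.target → φ.symm p ∈ χ.target := fun hp => by
      rw [hχt]; exact φ.map_target hp
    simpa [τ] using h3
  · have h0 : τ 0 = b := by simp [τ, heisenbergTranslation_apply]
    change φ (χ (τ 0)) = q
    rw [h0, χ.right_inv hqs, φ.right_inv hq]

lemma IsContactBall.isOpen {B : Set M} (hB : IsContactBall ξ B) : IsOpen B := by
  obtain ⟨φ, -, -, rfl⟩ := hB
  exact φ.open_target

lemma IsContactBall.nonempty {B : Set M} (hB : IsContactBall ξ B) : B.Nonempty := by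
  obtain ⟨φ, -, hs, rfl⟩ := hB
  obtain ⟨χ, hχs, hχt, -⟩ := hs.exists_symm
  exact ⟨φ (χ 0), φ.map_source (by rw [← hχt]; exact χ.map_source (by rw [hχs]; trivial))⟩

/-- A compact subset of a contact ball can be moved into any open set that meets the ball by a
contact symmetry supported in the ball. -/
theorem IsContactBall.exists_symmetry_mapsTo [T2Space M] {B K N : Set M} (hB : IsContactBall ξ B)
    (hK : IsCompact K) (hKB : K ⊆ B) (hN : IsOpen N) (hNB : (N ∩ B).Nonempty) :
    ∃ Φ : M ≃ M, IsContactSymmetry ξ B Φ ∧ ∀ p ∈ K, Φ p ∈ N := by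
  obtain ⟨q, hqN, hqB⟩ := hNB
  obtain ⟨φ, hφ, hs, rfl, rfl⟩ := hB.exists_centered_chart hqB
  have hK' : IsCompact (φ.symm '' K) :=
    hK.image_of_continuousOn (φ.continuousOn_symm.mono hKB)
  obtain ⟨R, hR, hKR⟩ := hK'.isBounded.subset_closedBall_lt 0 0
  obtain ⟨C, hC, f, hf, c, hc1, hc0, hfc⟩ := exists_preservesKer_contracting n hR
  have hφs : ∀ u, u ∈ φ.source := fun u => by rw [hs]; trivial
  obtain ⟨Φ, hΦ, hΦf⟩ := exists_isContactSymmetry hφ.contMDiffOn hφ.contMDiffOn_symm hf hC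
    (fun u _ => hφs u) (fun u _ => hφ.pullback_eq u (hφs u))
  have hΦB : IsContactSymmetry ξ φ.target Φ := hΦ.mono (by
    rintro _ ⟨u, -, rfl⟩
    exact φ.map_source (hφs u))
  have hN' : φ ⁻¹' N ∈ nhds (0 : ContactModel n) :=
    (φ.continuousAt (hφs 0)).preimage_mem_nhds (hN.mem_nhds hqN)
  obtain ⟨ε, hε, hεN⟩ := Metric.mem_nhds_iff.1 hN'
  obtain ⟨m, hm⟩ : ∃ m : ℕ, c ^ m * R < ε := by
    have h1 := (tendsto_pow_atTop_nhds_zero_of_lt_one hc0 hc1).mul_const R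
    rw [zero_mul] at h1
    exact (h1.eventually (gt_mem_nhds hε)).exists
  -- The iterates never leave the ball of radius `R`, so the contraction estimate applies at every
  -- stage.
  have hiter : ∀ k : ℕ, ∀ u ∈ Metric.closedBall (0 : ContactModel n) R,
      ‖f^[k] u‖ ≤ c ^ k * ‖u‖ ∧ ((Φ : Equiv.Perm M) ^ k) (φ u) = φ (f^[k] u) := by
    intro k
    induction k with
    | zero => intro u _; simp
    | succ k ih =>
      intro u hu
      obtain ⟨h1, h2⟩ := ih u hu
      have hmem : f^[k] u ∈ Metric.closedBall (0 : ContactModel n) R := by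
        rw [mem_closedBall_zero_iff] at hu ⊢
        exact (h1.trans (mul_le_of_le_one_left (norm_nonneg _) (pow_le_one₀ hc0 hc1.le))).trans hu
      rw [Function.iterate_succ_apply']
      constructor
      · rw [pow_succ', mul_assoc]
        exact (hfc _ hmem).trans (mul_le_mul_of_nonneg_left h1 hc0)
      · rw [pow_succ', Equiv.Perm.mul_apply, h2, hΦf _ (hφs _)]
  refine ⟨(Φ : Equiv.Perm M) ^ m, hΦB.pow m, fun p hp => ?_⟩
  have hu := hKR (mem_image_of_mem φ.symm hp)
  obtain ⟨h1, h2⟩ := hiter m _ hu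
  rw [φ.right_inv (hKB hp)] at h2
  rw [h2]
  apply hεN
  rw [mem_ball_zero_iff]
  rw [mem_closedBall_zero_iff] at hu
  exact (h1.trans (mul_le_mul_of_nonneg_left hu (pow_nonneg hc0 m))).trans_lt hm

end ContactBalls

/-- A curve whose initial velocity points from `γ 0` towards `s` enters the ball around `s` whose
sphere contains `γ 0`. -/
lemma exists_dist_lt_of_hasDerivWithinAt {F : Type*} [NormedAddCommGroup F] [NormedSpace ℝ F]
    {γ : ℝ → F} {s : F} {c : ℝ} (hc : 0 < c) (hne : γ 0 ≠ s)
    (hγ : HasDerivWithinAt γ (c • (s - γ 0)) (Icc 0 1) 0) :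
    ∃ t ∈ Icc (0 : ℝ) 1, dist (γ t) s < dist (γ 0) s := by
  have hd : 0 < dist (γ 0) s := dist_pos.2 hne
  -- The error is held to half of the first-order gain `c * dist (γ 0) s * t`.
  have h1 := (hasDerivWithinAt_iff_isLittleO.1 hγ).def (c := c * dist (γ 0) s / 2) (by positivity)
  have h2 : nhdsWithin (0 : ℝ) (Ioo 0 (min 1 c⁻¹)) ≤ nhdsWithin 0 (Icc 0 1) :=
    nhdsWithin_mono _ fun t ht => ⟨ht.1.le, (ht.2.trans_le (min_le_left _ _)).le⟩
  have : (nhdsWithin (0 : ℝ) (Ioo 0 (min 1 c⁻¹))).NeBot :=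
    left_nhdsWithin_Ioo_neBot (by positivity)
  obtain ⟨t, ht, ht'⟩ := ((h1.filter_mono h2).and self_mem_nhdsWithin).exists
  have ht0 : 0 < t := ht'.1
  have hct : c * t ≤ 1 := by
    have := (ht'.2.trans_le (min_le_right _ _)).le
    calc c * t ≤ c * c⁻¹ := by gcongr
      _ = 1 := mul_inv_cancel₀ hc.ne'
  refine ⟨t, ⟨ht0.le, (ht'.2.trans_le (min_le_left _ _)).le⟩, ?_⟩
  rw [sub_zero, Real.norm_of_nonneg ht0.le] at ht
  have h3 : γ t - s = (γ t - γ 0 - t • c • (s - γ 0)) + (1 - c * t) • (γ 0 - s) := by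
    module
  rw [dist_eq_norm (γ t), h3]
  refine (norm_add_le _ _).trans_lt ?_
  rw [norm_smul, Real.norm_of_nonneg (by linarith), ← dist_eq_norm (γ 0)]
  have : 0 < c * dist (γ 0) s * t := by positivity
  nlinarith

/-! ### Reaching further points and merging contact balls. -/

section Merging

variable {n : ℕ} {M : Type*} [TopologicalSpace M] [ChartedSpace (ContactModel n) M]
  {ξ : TangentDistribution n M}

local notation "𝓘ₙ" => 𝓘(ℝ, ContactModel n)

/-- Near every boundary point `q` of an open set `S`, a contact symmetry supported near `q` moves
some point of the complement of `S` into `S`. -/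
theorem IsContactStructure.exists_symmetry_mem [T2Space M] [IsManifold 𝓘ₙ ∞ M]
    (hξ : IsContactStructure ξ) {S O : Set M} (hS : IsOpen S) {q : M} (hq : q ∈ closure S)
    (hqS : q ∉ S) (hO : IsOpen O) (hqO : q ∈ O) :
    ∃ b ∉ S, ∃ Φ : M ≃ M, IsContactSymmetry ξ O Φ ∧ Φ b ∈ S := by
  obtain ⟨W, α, hW, hqW, hWt, hα, hcont⟩ := hξ q
  have hform : IsContactFormOn α W :=
    isContactFormOn_of_wedgePow_ne_zero hW hα fun u hu => (hcont u hu).2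
  set e : OpenPartialHomeomorph (ContactModel n) M := (chartAt (ContactModel n) q).symm with he
  have hes : ContMDiffOn 𝓘ₙ 𝓘ₙ ∞ e e.source := contMDiffOn_chart_symm
  have hes' : ContMDiffOn 𝓘ₙ 𝓘ₙ ∞ e.symm e.target := by
    rw [he, OpenPartialHomeomorph.symm_symm]; exact contMDiffOn_chart
  have hWe : W ⊆ e.source := hWt
  have heW : ContinuousOn e W := e.continuousOn.mono hWe
  set q₀ : ContactModel n := chartAt (ContactModel n) q q with hq₀
  have heq : e q₀ = q := (chartAt (ContactModel n) q).left_inv (mem_chart_source _ q)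
  let W' : Set (ContactModel n) := W ∩ e ⁻¹' O
  have hW' : IsOpen W' := heW.isOpen_inter_preimage hW hO
  have hqW' : q₀ ∈ W' := ⟨hqW, by rw [mem_preimage, heq]; exact hqO⟩
  have hform' : IsContactFormOn α W' := hform.mono hW' inter_subset_left
  let S' : Set (ContactModel n) := W ∩ e ⁻¹' S
  have hS' : IsOpen S' := heW.isOpen_inter_preimage hW hS
  have hqS' : q₀ ∉ S' := fun h => hqS (by rw [← heq]; exact h.2)
  obtain ⟨ε, hε, hball⟩ := Metric.nhds_basis_closedBall.mem_iff.1 (hW'.mem_nhds hqW')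
  -- With `s` within `ε / 2` of `q₀`, every point closer to `s` than `q₀` is lies within `ε` of
  -- `q₀`, so the search for a nearest point can be confined to a compact ball.
  obtain ⟨s, hsS, hsq⟩ : ∃ s ∈ S', dist s q₀ < ε / 2 := by
    have hopen : IsOpen (e '' Metric.ball q₀ (ε / 2)) := by
      refine e.isOpen_image_of_subset_source Metric.isOpen_ball fun u hu => hWe (hball ?_).1
      exact Metric.ball_subset_closedBall (Metric.ball_subset_ball (by linarith) hu)
    obtain ⟨_, ⟨s, hs, rfl⟩, hsS⟩ := mem_closure_iff.1 hq _ hopen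
      ⟨q₀, Metric.mem_ball_self (by positivity), heq⟩
    exact ⟨s, ⟨(hball (Metric.ball_subset_closedBall
      (Metric.ball_subset_ball (by linarith) hs))).1, hsS⟩, hs⟩
  have hA : IsCompact (Metric.closedBall q₀ ε \ S') := (isCompact_closedBall q₀ ε).diff hS'
  -- By minimality the open ball around `s` with `b` on its sphere lies in `S'`, so any motion from
  -- `b` with initial velocity towards `s` enters `S'`.
  obtain ⟨b, hbA, hbmin⟩ := hA.exists_isMinOn
    ⟨q₀, Metric.mem_closedBall_self hε.le, hqS'⟩
    (continuous_id.dist continuous_const : Continuous fun u => dist u s).continuousOn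
  have hbq : dist b s ≤ dist q₀ s := hbmin ⟨Metric.mem_closedBall_self hε.le, hqS'⟩
  have hbW' : b ∈ W' := hball hbA.1
  have hsub : ∀ u, dist u s < dist b s → u ∈ S' := by
    intro u hu
    by_contra hn
    have hu' : u ∈ Metric.closedBall q₀ ε := by
      rw [Metric.mem_closedBall]
      have := dist_triangle u s q₀
      rw [dist_comm q₀ s] at hbq
      linarith
    exact absurd (hbmin ⟨hu', hn⟩) (not_le.2 hu)
  have hbs : b ≠ s := fun h => hbA.2 (h ▸ hsS)
  obtain ⟨C, hCW, hC, V, hV, hVb⟩ := hform'.exists_isInfinitesimalSymmetry_eq hbW' (s - b)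
  obtain ⟨c, hc, K, hK, φ, hφ, hflow⟩ := hV.exists_flow hC fun u hu =>
    hform'.differentiableAt (hCW hu)
  obtain ⟨t, ht, hdist⟩ := exists_dist_lt_of_hasDerivWithinAt (γ := fun t => φ t b) (s := s) hc
    (by simpa [hφ.zero] using hbs)
    (by
      have := hφ.deriv 0 (left_mem_Icc.2 zero_le_one) b
      simpa [hφ.zero, hVb] using this)
  simp only [hφ.zero] at hdist
  obtain ⟨f, hfφ, hf⟩ := hflow t ht
  obtain ⟨Φ, hΦ, hΦf⟩ := exists_isContactSymmetry hes hes' hf hC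
    (fun u hu => hWe (hCW hu).1) (fun u hu => (hcont u (hCW hu).1).1)
  refine ⟨e b, fun h => hbA.2 ⟨hbW'.1, h⟩, Φ, hΦ.mono ?_, ?_⟩
  · rintro _ ⟨u, hu, rfl⟩
    exact (hCW hu).2
  · rw [hΦf b (hWe hbW'.1), hfφ]
    exact (hsub _ hdist).2

/-- In a connected contact manifold, a contact ball containing a compact set can be replaced by one
that contains a given further point. -/
theorem IsContactStructure.exists_isContactBall_insert [T2Space M] [ConnectedSpace M]
    [IsManifold 𝓘ₙ ∞ M] (hξ : IsContactStructure ξ) {B K : Set M} (hB : IsContactBall ξ B)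
    (hK : IsCompact K) (hKB : K ⊆ B) (q : M) :
    ∃ B', IsContactBall ξ B' ∧ K ⊆ B' ∧ q ∈ B' := by
  let S : Set M := {q | ∃ B', IsContactBall ξ B' ∧ K ⊆ B' ∧ q ∈ B'}
  have hSo : IsOpen S := by
    rw [isOpen_iff_mem_nhds]
    rintro x ⟨B', hB', hKB', hx⟩
    filter_upwards [hB'.isOpen.mem_nhds hx] with y hy
    exact ⟨B', hB', hKB', hy⟩
  have hSc : IsClosed S := by
    refine isClosed_of_closure_subset fun x hx => ?_
    by_contra hxS
    have hxK : x ∈ Kᶜ := fun h => hxS ⟨B, hB, hKB, hKB h⟩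
    -- As `Φ` fixes `K` pointwise, `Φ ⁻¹' B'` is a contact ball containing both `K` and `b`, against
    -- `b ∉ S`.
    obtain ⟨b, hbS, Φ, hΦ, B', hB', hKB', hbB'⟩ :=
      hξ.exists_symmetry_mem hSo hx hxS hK.isClosed.isOpen_compl hxK
    refine hbS ⟨Φ ⁻¹' B', hΦ.symm.isContactBall hB', fun p hp => ?_, hbB'⟩
    rw [mem_preimage, hΦ.eq_self p (fun h => h hp)]
    exact hKB' hp
  obtain ⟨b, hb⟩ := hB.nonempty
  have hS : S = univ := IsClopen.eq_univ ⟨hSc, hSo⟩ ⟨b, B, hB, hKB, hb⟩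
  have : q ∈ S := hS ▸ mem_univ q
  exact this

/-- Compact subsets of disjoint contact balls, finite in number, lie in a common contact ball. -/
theorem IsContactStructure.exists_isContactBall_biUnion [T2Space M] [ConnectedSpace M]
    [IsManifold 𝓘ₙ ∞ M] (hξ : IsContactStructure ξ) {ι : Type*} [Finite ι] [Nonempty ι]
    {U : ι → Set M} (hU : ∀ j, IsContactBall ξ (U j))
    (hdisj : Pairwise fun i j => Disjoint (U i) (U j)) {K : Set M} (hK : IsCompact K)
    (hKU : K ⊆ ⋃ j, U j) (s : Finset ι) :
    ∃ B, IsContactBall ξ B ∧ K ∩ ⋃ j ∈ s, U j ⊆ B := by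
  classical
  have hcompact : ∀ s : Finset ι, IsCompact (K ∩ ⋃ j ∈ s, U j) := by
    intro s
    -- By disjointness, selecting some of the balls inside `K` amounts to removing the other ones,
    -- which are open.
    have : K ∩ ⋃ j ∈ s, U j = K \ ⋃ j ∈ (s : Set ι)ᶜ, U j := by
      ext p
      simp only [mem_inter_iff, mem_iUnion, mem_sdiff, mem_compl_iff, Finset.mem_coe, exists_prop,
        not_exists, not_and, and_congr_right_iff]
      intro hp
      constructor
      · rintro ⟨i, hi, hpi⟩ j hj hpj
        exact disjoint_left.1 (hdisj (fun h : i = j => hj (h ▸ hi))) hpi hpj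
      · intro h
        obtain ⟨j, hj⟩ := mem_iUnion.1 (hKU hp)
        exact ⟨j, by_contra fun hjs => h j hjs hj, hj⟩
    rw [this]
    exact hK.diff (isOpen_biUnion fun j _ => (hU j).isOpen)
  induction s using Finset.induction_on with
  | empty =>
    obtain ⟨j⟩ := ‹Nonempty ι›
    exact ⟨U j, hU j, by simp⟩
  | insert j s hj ih =>
    obtain ⟨B₀, hB₀, hKB₀⟩ := ih
    obtain ⟨p, hp⟩ := (hU j).nonempty
    -- Squeezing `K ∩ U j` into a ball needs that ball to meet `U j`, hence the added point `p`.
    obtain ⟨B, hB, hKB, hpB⟩ := hξ.exists_isContactBall_insert hB₀ (hcompact s) hKB₀ p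
    have hKj : IsCompact (K ∩ U j) := by simpa using hcompact {j}
    obtain ⟨Φ, hΦ, hΦK⟩ := (hU j).exists_symmetry_mapsTo hKj inter_subset_right hB.isOpen
      ⟨p, hpB, hp⟩
    -- The map `Φ` takes `K ∩ U j` into `B` and is the identity on the other balls, so this preimage
    -- contains both parts.
    refine ⟨Φ ⁻¹' B, hΦ.symm.isContactBall hB, ?_⟩
    rintro x ⟨hxK, hx⟩
    simp only [Finset.mem_insert, iUnion_iUnion_eq_or_left, mem_union] at hx
    rcases hx with hx | hx
    · exact hΦK x ⟨hxK, hx⟩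
    · have hxj : x ∉ U j := by
        obtain ⟨i, hi, hxi⟩ := mem_iUnion₂.1 hx
        exact disjoint_left.1 (hdisj (fun h : i = j => hj (h ▸ hi))) hxi
      rw [mem_preimage, hΦ.eq_self x hxj]
      exact hKB ⟨hxK, hx⟩

end Merging

end
theorem propositionp {n : ℕ} {M : Type*} [TopologicalSpace M] [T2Space M]
    [SecondCountableTopology M] [ConnectedSpace M] [ChartedSpace (ContactModel n) M]
    [IsManifold 𝓘(ℝ, ContactModel n) ∞ M]
    (ξ : TangentDistribution n M) (hξ : IsContactStructure ξ)
    (k : ℕ) (hk : 1 ≤ k) (U : Fin k → Set M) (hU : ∀ j, IsContactBall ξ (U j))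
    (hdisj : Pairwise (fun i j => Disjoint (U i) (U j)))
    (K : Set M) (hK : IsCompact K) (hKU : K ⊆ ⋃ j, U j) :
    ∃ B : Set M, IsContactBall ξ B ∧ K ⊆ B := by
  have : Nonempty (Fin k) := ⟨⟨0, hk⟩⟩
  obtain ⟨B, hB, hKB⟩ := hξ.exists_isContactBall_biUnion hU hdisj hK hKU Finset.univ
  exact ⟨B, hB, fun p hp => hKB ⟨hp, by simpa using hKU hp⟩⟩
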